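/- Let $G$ be a finite simple graph with at least one vertex. A set $S\subseteq V(G)$ is dominating if every vertex not in $S$ has a neighbor in $S$. Let $\gamma(G)$ be the minimum size of a dominating set of $G$, and let $i(G)$ be the minimum size of a dominating set of $G$ that is also independent. Theorem. If $G$ is cubic (that is, $3$-regular) and contains no cycle of length $4$ as a (not necessarily induced) subgraph, then $$\frac{i(G)}{\gamma(G)}\le \frac{5}{4}.$$ -/

import Mathlib

namespace SimpleGraph

variable {V : Type*}

/-- A set `S` of vertices is dominating if every vertex outside `S` has a neighbor in `S`. -/
def IsDominatingSet (G : SimpleGraph V) (S : Set V) : Prop :=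
  ∀ v, v ∉ S → ∃ u ∈ S, G.Adj v u

/-- The domination number `γ(G)`: the minimum size of a (finite) dominating set. -/
noncomputable def dominationNumber (G : SimpleGraph V) : ℕ :=
  sInf {n | ∃ S : Finset V, G.IsDominatingSet (S : Set V) ∧ S.card = n}

/-- The independent domination number `i(G)`: the minimum size of a (finite) dominating set
that is also independent. -/
noncomputable def independentDominationNumber (G : SimpleGraph V) : ℕ :=
  sInf {n | ∃ S : Finset V,
    G.IsDominatingSet (S : Set V) ∧ G.IsIndepSet (S : Set V) ∧ S.card = n}

/-- `G` has no cycle of length four (as a subgraph, not necessarily induced). -/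
def HasNoFourCycle (G : SimpleGraph V) : Prop :=
  ∀ (v : V) (p : G.Walk v v), p.IsCycle → p.length ≠ 4

/-- Every finite graph has an independent dominating set, so the minima above are over
nonempty sets. -/
theorem exists_independent_dominating [Finite V] (G : SimpleGraph V) :
    ∃ S : Finset V, G.IsDominatingSet (S : Set V) ∧ G.IsIndepSet (S : Set V) := by
  classical
  obtain ⟨M, hM⟩ := (Set.toFinite {S : Set V | G.IsIndepSet S}).exists_maximal
    ⟨∅, by simp [IsIndepSet]⟩
  refine ⟨(Set.toFinite M).toFinset, ?_, by simpa using hM.prop⟩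
  rw [Set.Finite.coe_toFinset]
  intro v hv
  by_contra! h
  have h1 : G.IsIndepSet (insert v M) := by
    refine Set.pairwise_insert.2 ⟨hM.prop, fun b hb _ => ⟨h b hb, fun hbv => h b hb hbv.symm⟩⟩
  exact hv (hM.le_of_ge h1 (Set.subset_insert v M) (Set.mem_insert v M))

end SimpleGraph

set_option linter.unusedSectionVars false

/-! Among the minimum dominating sets, take `D` with the fewest inner edges. Every vertex of `D`
with a neighbour in `D` then has two non-adjacent private neighbours (`exists_private_pair`). In a
cubic graph this leaves it a single inner edge, so `D` consists of isolated vertices `I` and a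
perfectly matched set `X`. Each center in `X` has two leaves in `P`; the remaining vertices `O` have
neighbours in `I` and none in `X`.

Keep a random vertex of each matched pair. This frees `|X|` leaves, which induce maximum degree at
most two and hence are dominated independently by half of their number plus half of the number of
isolated ones. A leaf with a neighbouring leaf is freed together with it with probability 1/4,
because the absence of 4-cycles prevents their centers from being partners. If `a` leaves are lone,
then since `|P| = 2|X|` the expected total is at most `|I| + 5/4 |X| + a/8`.

To absorb `a/8`, replace some `Z ⊆ I` by a maximal independent set of outer vertices whose
neighbours in `I` all lie in `Z`. Each freed lone leaf covered this way saves one vertex. Profitable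
members of `I` enter `Z` with probability 1/3. The gain of `z`, averaged over a selection and its
complement, is at least `(leafShare z - 4)/16` (`gain_pair_bound`). The shares add up to `2a`, so
the total gain is at least `a/8 - |I|/4`, which leaves `5/4 (|I| + |X|)`. -/

namespace SimpleGraph

/-! ### Domination in maximum degree two, and a derandomised choice. -/

section Generic

variable {V : Type*} [DecidableEq V] (G : SimpleGraph V) [DecidableRel G.Adj]

/-- The vertices of `S` that are isolated in the subgraph induced by `S`. -/
def isolatedIn (S : Finset V) : Finset V := S.filter fun v => ∀ u ∈ S, ¬ G.Adj v u

variable {G} in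
theorem mem_isolatedIn {S : Finset V} {v : V} :
    v ∈ G.isolatedIn S ↔ v ∈ S ∧ ∀ u ∈ S, ¬ G.Adj v u := Finset.mem_filter

/-- Every finite set contains an independent subset that dominates it. -/
theorem exists_indep_subset_dominating (S : Finset V) :
    ∃ M ⊆ S, G.IsIndepSet (M : Set V) ∧ ∀ v ∈ S, v ∉ M → ∃ u ∈ M, G.Adj v u := by
  induction S using Finset.strongInduction with
  | H S ih =>
    rcases S.eq_empty_or_nonempty with rfl | ⟨v, hv⟩
    · exact ⟨∅, by simp [IsIndepSet]⟩
    obtain ⟨M, hMS, hind, hdom⟩ := ih (S.filter fun u => u ≠ v ∧ ¬ G.Adj v u)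
      (Finset.filter_ssubset.2 ⟨v, hv, by simp⟩)
    refine ⟨insert v M, ?_, ?_, ?_⟩
    · exact Finset.insert_subset hv (hMS.trans (Finset.filter_subset _ _))
    · rw [Finset.coe_insert]
      refine Set.pairwise_insert.2 ⟨hind, fun b hb _ => ?_⟩
      have := (Finset.mem_filter.1 (hMS hb)).2.2
      exact ⟨this, fun h => this h.symm⟩
    · intro u hu huM
      rw [Finset.mem_insert, not_or] at huM
      by_cases h : G.Adj v u
      · exact ⟨v, by simp, h.symm⟩
      · obtain ⟨t, ht, h'⟩ := hdom u (by simp [hu, huM.1, h]) huM.2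
        exact ⟨t, by simp [ht], h'⟩

/-- This is the greedy step: deleting the closed neighbourhood of `v` must lower `|S|` plus the
number of isolated vertices by at least two. Suitable choices of `v` are an isolated vertex, else
the neighbour of a vertex of degree one, else any vertex of a 2-regular set. -/
theorem exists_card_isolatedIn_filter_lt (S : Finset V) (hS : S.Nonempty)
    (hdeg : ∀ v ∈ S, (S.filter (G.Adj v)).card ≤ 2) :
    ∃ v ∈ S, (G.isolatedIn (S.filter fun u => u ≠ v ∧ ¬ G.Adj v u)).card + 1 ≤
      (S.filter (G.Adj v)).card + (G.isolatedIn S).card := by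
  by_cases hiso : ∃ v ∈ S, ∀ u ∈ S, ¬ G.Adj v u
  · obtain ⟨v, hv, hvS⟩ := hiso
    refine ⟨v, hv, ?_⟩
    have hvi : v ∈ G.isolatedIn S := by simp [isolatedIn, hv]; exact hvS
    have : G.isolatedIn (S.filter fun u => u ≠ v ∧ ¬ G.Adj v u) ⊆ (G.isolatedIn S).erase v := by
      intro w hw
      simp only [isolatedIn, Finset.mem_filter, Finset.mem_erase] at hw ⊢
      refine ⟨hw.1.2.1, hw.1.1, fun u hu => ?_⟩
      by_cases huv : u = v
      · subst huv; exact fun h => hw.1.2.2 h.symm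
      · exact hw.2 u ⟨hu, huv, hvS u hu⟩
    have h1 := Finset.card_le_card this
    rw [Finset.card_erase_of_mem hvi] at h1
    have := Finset.card_pos.2 ⟨v, hvi⟩
    omega
  push Not at hiso
  -- It suffices to find `v` and `t` such that each newly isolated vertex is a neighbour of `t`.
  have key : ∀ v ∈ S, ∀ t ∈ S, G.Adj v t →
      (∀ s ∈ G.isolatedIn (S.filter fun u => u ≠ v ∧ ¬ G.Adj v u), G.Adj t s) →
      (S.filter (G.Adj v)).card = 2 →
      (G.isolatedIn (S.filter fun u => u ≠ v ∧ ¬ G.Adj v u)).card + 1 ≤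
        (S.filter (G.Adj v)).card + (G.isolatedIn S).card := by
    intro v hv t ht hvt hs hv2
    have h1 : G.isolatedIn (S.filter fun u => u ≠ v ∧ ¬ G.Adj v u) ⊆
        (S.filter (G.Adj t)).erase v := by
      intro s h
      have h' := hs s h
      simp only [isolatedIn, Finset.mem_filter, Finset.mem_erase] at h ⊢
      exact ⟨h.1.2.1, h.1.1, h'⟩
    have h2 := Finset.card_le_card h1
    rw [Finset.card_erase_of_mem (by simp [hv, hvt.symm])] at h2
    have := hdeg t ht
    omega
  by_cases hleaf : ∃ u ∈ S, (S.filter (G.Adj u)).card = 1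
  · obtain ⟨u, hu, hu1⟩ := hleaf
    obtain ⟨v, hv⟩ := Finset.card_eq_one.1 hu1
    have hvm : v ∈ S.filter (G.Adj u) := by simp [hv]
    obtain ⟨hvS, huv⟩ := Finset.mem_filter.1 hvm
    refine ⟨v, hvS, ?_⟩
    by_cases hex : ∃ t ∈ S, t ≠ u ∧ G.Adj v t
    · obtain ⟨t, ht, htu, hvt⟩ := hex
      have hsub : ({u, t} : Finset V) ⊆ S.filter (G.Adj v) := by
        intro a; simp only [Finset.mem_insert, Finset.mem_singleton, Finset.mem_filter]
        rintro (rfl | rfl)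
        · exact ⟨hu, huv.symm⟩
        · exact ⟨ht, hvt⟩
      have hc2 : ({u, t} : Finset V).card = 2 := Finset.card_pair htu.symm
      have heq := Finset.eq_of_subset_of_card_le hsub (by rw [hc2]; exact hdeg v hvS)
      refine key v hvS t ht hvt ?_ (by rw [← heq, hc2])
      -- A newly isolated `s` has lost a neighbour among `u` and `t`. It cannot be `u`, whose only
      -- neighbour is `v`.
      intro s hs
      simp only [isolatedIn, Finset.mem_filter] at hs
      obtain ⟨r, hr, hsr⟩ := hiso s hs.1.1
      by_cases hrv : r = v
      · subst hrv; exact absurd hsr.symm hs.1.2.2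
      by_cases hvr : G.Adj v r
      · have : r ∈ ({u, t} : Finset V) := by rw [heq]; simp [hr, hvr]
        rcases Finset.mem_insert.1 this with rfl | h
        · have : s ∈ S.filter (G.Adj r) := by simp [hs.1.1, hsr.symm]
          rw [hv, Finset.mem_singleton] at this
          exact absurd this hs.1.2.1
        · rw [Finset.mem_singleton] at h; subst h; exact hsr.symm
      · exact absurd hsr (hs.2 r ⟨hr, hrv, hvr⟩)
    · push Not at hex
      have hempty : G.isolatedIn (S.filter fun u => u ≠ v ∧ ¬ G.Adj v u) = ∅ := by
        refine Finset.eq_empty_of_forall_notMem fun s hs => ?_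
        simp only [isolatedIn, Finset.mem_filter] at hs
        obtain ⟨r, hr, hsr⟩ := hiso s hs.1.1
        by_cases hrv : r = v
        · subst hrv; exact absurd hsr.symm hs.1.2.2
        by_cases hvr : G.Adj v r
        · have hru : r = u := by
            by_contra h; exact hex r hr h hvr
          subst hru
          have : s ∈ S.filter (G.Adj r) := by simp [hs.1.1, hsr.symm]
          rw [hv, Finset.mem_singleton] at this
          exact absurd this hs.1.2.1
        · exact absurd hsr (hs.2 r ⟨hr, hrv, hvr⟩)
      have : 0 < (S.filter (G.Adj v)).card := Finset.card_pos.2 ⟨u, by simp [hu, huv.symm]⟩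
      rw [hempty]; simp; omega
  · push Not at hleaf
    have h2 : ∀ v ∈ S, (S.filter (G.Adj v)).card = 2 := by
      intro v hv
      obtain ⟨r, hr, hvr⟩ := hiso v hv
      have : 0 < (S.filter (G.Adj v)).card := Finset.card_pos.2 ⟨r, by simp [hr, hvr]⟩
      have := hdeg v hv
      have := hleaf v hv
      omega
    obtain ⟨v, hv⟩ := hS
    obtain ⟨t, ht, hvt⟩ := hiso v hv
    refine ⟨v, hv, key v hv t ht hvt ?_ (h2 v hv)⟩
    intro s hs
    simp only [isolatedIn, Finset.mem_filter] at hs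
    -- A newly isolated `s` lost both its neighbours, so it shares them with `v`: the two lie on a
    -- common 4-cycle, which is allowed here.
    have hsub : S.filter (G.Adj s) ⊆ S.filter (G.Adj v) := by
      intro r hr
      simp only [Finset.mem_filter] at hr ⊢
      refine ⟨hr.1, ?_⟩
      by_contra hvr
      have hrv : r ≠ v := by rintro rfl; exact hs.1.2.2 hr.2.symm
      exact hs.2 r ⟨hr.1, hrv, hvr⟩ hr.2
    have heq := Finset.eq_of_subset_of_card_le hsub (by rw [h2 v hv, h2 s hs.1.1])
    have : t ∈ S.filter (G.Adj s) := by rw [heq]; simp [ht, hvt]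
    exact (Finset.mem_filter.1 this).2.symm

/-- A set inducing a graph of maximum degree at most two contains an independent subset
that dominates it and has at most half of its non-isolated vertices. -/
theorem exists_indep_subset_dominating_card_le (S : Finset V)
    (hdeg : ∀ v ∈ S, (S.filter (G.Adj v)).card ≤ 2) :
    ∃ M ⊆ S, G.IsIndepSet (M : Set V) ∧ (∀ v ∈ S, v ∉ M → ∃ u ∈ M, G.Adj v u) ∧
      2 * M.card ≤ S.card + (G.isolatedIn S).card := by
  induction S using Finset.strongInduction with
  | H S ih =>
    rcases S.eq_empty_or_nonempty with rfl | hne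
    · exact ⟨∅, by simp [IsIndepSet]⟩
    obtain ⟨v, hv, hcard⟩ := G.exists_card_isolatedIn_filter_lt S hne hdeg
    set T := S.filter fun u => u ≠ v ∧ ¬ G.Adj v u with hT
    obtain ⟨M, hMS, hind, hdom, hM⟩ := ih T (Finset.filter_ssubset.2 ⟨v, hv, by simp⟩) (by
      intro u hu
      refine le_trans (Finset.card_le_card ?_) (hdeg u (Finset.mem_filter.1 hu).1)
      exact Finset.filter_subset_filter _ (Finset.filter_subset _ _))
    refine ⟨insert v M, ?_, ?_, ?_, ?_⟩
    · exact Finset.insert_subset hv (hMS.trans (Finset.filter_subset _ _))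
    · rw [Finset.coe_insert]
      refine Set.pairwise_insert.2 ⟨hind, fun b hb _ => ?_⟩
      have := (Finset.mem_filter.1 (hMS hb)).2.2
      exact ⟨this, fun h => this h.symm⟩
    · intro u hu huM
      rw [Finset.mem_insert, not_or] at huM
      by_cases h : G.Adj v u
      · exact ⟨v, by simp, h.symm⟩
      · obtain ⟨t, ht, h'⟩ := hdom u (by simp [hT, hu, huM.1, h]) huM.2
        exact ⟨t, by simp [ht], h'⟩
    · have h1 : S = insert v (S.filter (G.Adj v) ∪ T) := by
        ext u
        simp only [hT, Finset.mem_insert, Finset.mem_union, Finset.mem_filter]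
        constructor
        · intro hu; tauto
        · rintro (rfl | h | h)
          exacts [hv, h.1, h.1]
      have h2 : S.card = 1 + (S.filter (G.Adj v)).card + T.card := by
        conv_lhs => rw [h1]
        rw [Finset.card_insert_of_notMem (by simp [hT]), Finset.card_union_of_disjoint]
        · omega
        · rw [Finset.disjoint_left]; intro a ha hb
          exact (Finset.mem_filter.1 hb).2.2 (Finset.mem_filter.1 ha).2
      have h3 := Finset.card_insert_le v M
      omega

/-- If each element of `E` is kept with probability `1/3`, then the expected number of `ℓ ∈ L`
that own a kept element, minus the expected cost, is attained by some outcome. -/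
theorem exists_subset_hitting {α β : Type*} [DecidableEq α] [DecidableEq β] (own : α → Finset β)
    (c : β → ℚ) (E : Finset β) (L : Finset α) :
    ∃ Z ⊆ E, ∑ ℓ ∈ L, (1 - (2 / 3 : ℚ) ^ (own ℓ ∩ E).card) - ∑ z ∈ E, c z / 3 ≤
      ((L.filter fun ℓ => (own ℓ ∩ Z).Nonempty).card : ℚ) - ∑ z ∈ Z, c z := by
  induction E using Finset.induction_on generalizing L with
  | empty => exact ⟨∅, by simp⟩
  | insert z E hz ih =>
    -- Conditional expectations: `Z₁` serves when `z` is kept, so that its owners' elements are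
    -- already hit, and `Z₂` when `z` is dropped. The outcomes are averaged with weights 1/3 and
    -- 2/3.
    obtain ⟨Z₁, hZ₁, h₁⟩ := ih (L.filter fun ℓ => z ∉ own ℓ)
    obtain ⟨Z₂, hZ₂, h₂⟩ := ih L
    have split : ∀ f : α → ℚ, ∑ ℓ ∈ L, f ℓ =
        ∑ ℓ ∈ L.filter (fun ℓ => z ∈ own ℓ), f ℓ + ∑ ℓ ∈ L.filter (fun ℓ => z ∉ own ℓ), f ℓ :=
      fun f => (Finset.sum_filter_add_sum_filter_not L _ f).symm
    have e1 : ∀ ℓ ∈ L.filter (fun ℓ => z ∉ own ℓ),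
        (1 - (2 / 3 : ℚ) ^ (own ℓ ∩ insert z E).card) = 1 - (2 / 3 : ℚ) ^ (own ℓ ∩ E).card := by
      intro ℓ hℓ
      rw [Finset.inter_insert_of_notMem (Finset.mem_filter.1 hℓ).2]
    have e2 : ∀ ℓ ∈ L.filter (fun ℓ => z ∈ own ℓ),
        (1 - (2 / 3 : ℚ) ^ (own ℓ ∩ insert z E).card) =
          1 / 3 + 2 / 3 * (1 - (2 / 3 : ℚ) ^ (own ℓ ∩ E).card) := by
      intro ℓ hℓ
      rw [Finset.inter_insert_of_mem (Finset.mem_filter.1 hℓ).2,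
        Finset.card_insert_of_notMem (by simp [hz]), pow_succ]
      ring
    rw [split, Finset.sum_congr rfl e1, Finset.sum_congr rfl e2, Finset.sum_add_distrib,
      ← Finset.mul_sum, Finset.sum_const, nsmul_eq_mul, Finset.sum_insert hz]
    rw [split] at h₂
    by_contra! hcon
    have hc1 := hcon (insert z Z₁) (Finset.insert_subset_insert _ hZ₁)
    have hc2 := hcon Z₂ (hZ₂.trans (Finset.subset_insert _ _))
    rw [Finset.sum_insert (fun h => hz (hZ₁ h))] at hc1
    have hcard : ((L.filter fun ℓ => z ∈ own ℓ).card : ℚ) +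
        (((L.filter fun ℓ => z ∉ own ℓ).filter fun ℓ => (own ℓ ∩ Z₁).Nonempty).card : ℚ) ≤
        ((L.filter fun ℓ => (own ℓ ∩ insert z Z₁).Nonempty).card : ℚ) := by
      rw [← Nat.cast_add, ← Finset.card_union_of_disjoint]
      · refine Nat.cast_le.2 (Finset.card_le_card fun ℓ hℓ => ?_)
        simp only [Finset.mem_union, Finset.mem_filter] at hℓ ⊢
        rcases hℓ with ⟨h, h'⟩ | ⟨⟨h, -⟩, h'⟩
        · exact ⟨h, z, by simp [h']⟩
        · exact ⟨h, h'.mono (Finset.inter_subset_inter_left (Finset.subset_insert _ _))⟩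
      · rw [Finset.disjoint_left]; intro a ha hb
        exact (Finset.mem_filter.1 (Finset.mem_filter.1 hb).1).2 (Finset.mem_filter.1 ha).2
    linarith

end Generic

/-! ### The structure of an extremal minimum dominating set. -/

section Partition

variable {V : Type*} [Fintype V] [DecidableEq V] (G : SimpleGraph V) [DecidableRel G.Adj]

/-- A partition of the vertex set induced by a dominating set `I ∪ X`: the vertices of `I` are
isolated in it, those of `X` are matched by `partner`, the vertices of `P` are the private
neighbours of their `center` in `X`, and `O` contains all other vertices. -/
structure IsStarPartition (I X P O : Finset V) (partner center : V → V) : Prop where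
  cover : ∀ v, v ∈ I ∨ v ∈ X ∨ v ∈ P ∨ v ∈ O
  disj_IX : Disjoint I X
  disj_IP : Disjoint I P
  disj_outer : Disjoint I O
  disj_XP : Disjoint X P
  disj_XO : Disjoint X O
  disj_PO : Disjoint P O
  outer_of_adj : ∀ z ∈ I, ∀ v, G.Adj z v → v ∈ O
  not_adj_outer : ∀ x ∈ X, ∀ w ∈ O, ¬ G.Adj x w
  exists_isolate : ∀ w ∈ O, ∃ z ∈ I, G.Adj w z
  partner_mem : ∀ x ∈ X, partner x ∈ X
  adj_partner : ∀ x ∈ X, G.Adj x (partner x)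
  eq_partner : ∀ x ∈ X, ∀ y ∈ X, G.Adj x y → y = partner x
  center_mem : ∀ ℓ ∈ P, center ℓ ∈ X
  adj_center : ∀ ℓ ∈ P, G.Adj ℓ (center ℓ)
  eq_center : ∀ ℓ ∈ P, ∀ x ∈ X, G.Adj ℓ x → x = center ℓ
  not_adj_of_center_eq : ∀ ℓ ∈ P, ∀ r ∈ P, center ℓ = center r → ¬ G.Adj ℓ r

theorem dominationNumber_le {V : Type*} (G : SimpleGraph V) {S : Finset V}
    (hS : G.IsDominatingSet (S : Set V)) :
    G.dominationNumber ≤ S.card := Nat.sInf_le ⟨S, hS, rfl⟩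

/-- The ordered pairs of adjacent vertices in `S`. -/
def adjPairs (S : Finset V) : Finset (V × V) := (S ×ˢ S).filter fun p => G.Adj p.1 p.2

theorem exists_minimum_dominating_adjPairs_minimal :
    ∃ D : Finset V, G.IsDominatingSet (D : Set V) ∧ D.card = G.dominationNumber ∧
      ∀ D' : Finset V, G.IsDominatingSet (D' : Set V) → D'.card = G.dominationNumber →
        (G.adjPairs D).card ≤ (G.adjPairs D').card := by
  classical
  have hne : {n | ∃ S : Finset V, G.IsDominatingSet (S : Set V) ∧ S.card = n}.Nonempty :=
    ⟨_, Finset.univ, fun v hv => absurd (by simp) hv, rfl⟩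
  obtain ⟨S, hS, hcard⟩ := Nat.sInf_mem hne
  obtain ⟨D, hD, hmin⟩ := Finset.exists_min_image
    (Finset.univ.filter fun D : Finset V =>
      G.IsDominatingSet (D : Set V) ∧ D.card = G.dominationNumber)
    (fun D => (G.adjPairs D).card) ⟨S, by simp [hS]; exact hcard⟩
  simp only [Finset.mem_filter, Finset.mem_univ, true_and] at hD hmin
  exact ⟨D, hD.1, hD.2, fun D' h1 h2 => hmin D' ⟨h1, h2⟩⟩

/-- In a minimum dominating set with the fewest inner edges, every vertex with an inner
neighbour has two non-adjacent private neighbours. -/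
theorem exists_private_pair {D : Finset V} (hD : G.IsDominatingSet (D : Set V))
    (hcard : D.card = G.dominationNumber)
    (hmin : ∀ D' : Finset V, G.IsDominatingSet (D' : Set V) → D'.card = G.dominationNumber →
        (G.adjPairs D).card ≤ (G.adjPairs D').card)
    {x y : V} (hx : x ∈ D) (hy : y ∈ D) (hxy : G.Adj x y) :
    ∃ u v, u ≠ v ∧ ¬ G.Adj u v ∧ (u ∉ D ∧ ∀ t ∈ D, G.Adj u t ↔ t = x) ∧
      (v ∉ D ∧ ∀ t ∈ D, G.Adj v t ↔ t = x) := by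
  have hyx : y ≠ x := hxy.ne'
  -- a vertex outside `D` that is not private to `x` is dominated without `x`
  have hother : ∀ v, v ∉ D → ¬ (∀ t ∈ D, G.Adj v t ↔ t = x) → ∃ t ∈ D, t ≠ x ∧ G.Adj v t := by
    intro v hv hvp
    by_contra! h
    obtain ⟨t, ht, hvt⟩ := hD v (by simpa using hv)
    have htx : t = x := by by_contra hne; exact h t ht hne hvt
    refine hvp fun s hs => ⟨fun hvs => ?_, ?_⟩
    · by_contra hne; exact h s hs hne hvs
    · rintro rfl; rwa [← htx]
  have hu : ∃ u, u ∉ D ∧ ∀ t ∈ D, G.Adj u t ↔ t = x := by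
    by_contra! hno
    have hdom : G.IsDominatingSet ((D.erase x : Finset V) : Set V) := by
      intro v hv
      simp only [Finset.coe_erase, Set.mem_sdiff, Finset.mem_coe, Set.mem_singleton_iff] at hv ⊢
      by_cases hvx : v = x
      · subst hvx; exact ⟨y, ⟨hy, hyx⟩, hxy⟩
      · have hvD : v ∉ D := fun h => hv ⟨h, hvx⟩
        obtain ⟨t, ht, htx, hvt⟩ := hother v hvD (fun h => by
          obtain ⟨t, ht, h'⟩ := hno v hvD
          have := h t ht
          tauto)
        exact ⟨t, ⟨ht, htx⟩, hvt⟩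
    have h1 := G.dominationNumber_le hdom
    rw [Finset.card_erase_of_mem hx] at h1
    have := Finset.card_pos.2 ⟨x, hx⟩
    omega
  obtain ⟨u, huD, hup⟩ := hu
  by_contra! hno
  -- If all private neighbours of `x` are adjacent to `u`, swapping `x` for `u` keeps domination and
  -- size. It destroys the edge `xy` and creates no inner edge, since `u` sees only `x` in `D`.
  set D' := insert u (D.erase x) with hD'
  have hdom : G.IsDominatingSet (D' : Set V) := by
    intro v hv
    simp only [hD', Finset.coe_insert, Finset.coe_erase, Set.mem_insert_iff, Set.mem_sdiff,
      Finset.mem_coe, Set.mem_singleton_iff, not_or] at hv ⊢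
    by_cases hvx : v = x
    · subst hvx; exact ⟨y, Or.inr ⟨hy, hyx⟩, hxy⟩
    have hvD : v ∉ D := fun h => hv.2 ⟨h, hvx⟩
    by_cases hvp : ∀ t ∈ D, G.Adj v t ↔ t = x
    · refine ⟨u, Or.inl rfl, ?_⟩
      by_contra hvu
      obtain ⟨t, ht, h'⟩ := hno u v (Ne.symm hv.1) (fun h => hvu h.symm) ⟨huD, hup⟩ hvD
      have := hvp t ht
      tauto
    · obtain ⟨t, ht, htx, hvt⟩ := hother v hvD hvp
      exact ⟨t, Or.inr ⟨ht, htx⟩, hvt⟩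
  have hcard' : D'.card = G.dominationNumber := by
    rw [hD', Finset.card_insert_of_notMem (by simp [huD]), Finset.card_erase_of_mem hx, ← hcard]
    have := Finset.card_pos.2 ⟨x, hx⟩
    omega
  have hlt : G.adjPairs D' ⊂ G.adjPairs D := by
    refine (Finset.ssubset_iff_of_subset ?_).2 ⟨(x, y), ?_, ?_⟩
    · rintro ⟨a, b⟩ hab
      simp only [adjPairs, hD', Finset.mem_filter, Finset.mem_product, Finset.mem_insert,
        Finset.mem_erase] at hab ⊢
      obtain ⟨⟨ha, hb⟩, hadj⟩ := hab
      rcases ha with rfl | ha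
      · rcases hb with rfl | hb
        · exact absurd hadj (G.loopless.irrefl _)
        · exact absurd ((hup b hb.2).1 hadj) hb.1
      · rcases hb with rfl | hb
        · exact absurd ((hup a ha.2).1 hadj.symm) ha.1
        · exact ⟨⟨ha.2, hb.2⟩, hadj⟩
    · simp [adjPairs, hx, hy, hxy]
    · have : x ≠ u := by rintro rfl; exact huD hx
      simp [adjPairs, hD', this]
  have := Finset.card_lt_card hlt
  have := hmin D' hdom hcard'
  omega

variable {G} in
-- An inner neighbour and two private neighbours exhaust the three edges at a vertex of `X`. So its
-- inner neighbour is unique and all its outside neighbours are private to it.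
theorem exists_isStarPartition (hcubic : G.IsRegularOfDegree 3) :
    ∃ (I X P O : Finset V) (partner center : V → V),
      G.IsStarPartition I X P O partner center ∧ I.card + X.card = G.dominationNumber := by
  obtain ⟨D, hD, hcard, hmin⟩ := G.exists_minimum_dominating_adjPairs_minimal
  set X := D.filter fun x => ∃ y ∈ D, G.Adj x y with hX
  set I := D.filter fun x => ¬ ∃ y ∈ D, G.Adj x y with hI
  set P := Finset.univ.filter fun v => v ∉ D ∧ ∃ x ∈ X, G.Adj v x with hP
  set O := Finset.univ.filter fun v => v ∉ D ∧ ¬ ∃ x ∈ X, G.Adj v x with hO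
  have key : ∀ x ∈ X, ∃ y u v, y ∈ X ∧ (∀ t, G.Adj x t ↔ t = y ∨ t = u ∨ t = v) ∧
      ¬ G.Adj u v ∧ (u ∉ D ∧ ∀ t ∈ D, G.Adj u t ↔ t = x) ∧
      (v ∉ D ∧ ∀ t ∈ D, G.Adj v t ↔ t = x) := by
    intro x hx
    obtain ⟨hxD, y, hy, hxy⟩ := Finset.mem_filter.1 hx
    obtain ⟨u, v, huv, hnadj, hu, hv⟩ := G.exists_private_pair hD hcard hmin hxD hy hxy
    refine ⟨y, u, v, Finset.mem_filter.2 ⟨hy, x, hxD, hxy.symm⟩, ?_, hnadj, hu, hv⟩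
    have hyu : y ≠ u := by rintro rfl; exact hu.1 hy
    have hyv : y ≠ v := by rintro rfl; exact hv.1 hy
    have hsub : ({y, u, v} : Finset V) ⊆ G.neighborFinset x := by
      intro t
      simp only [Finset.mem_insert, Finset.mem_singleton, mem_neighborFinset]
      rintro (rfl | rfl | rfl)
      exacts [hxy, ((hu.2 x hxD).2 rfl).symm, ((hv.2 x hxD).2 rfl).symm]
    have heq := Finset.eq_of_subset_of_card_le hsub (by
      rw [card_neighborFinset_eq_degree, hcubic x,
        Finset.card_eq_three.2 ⟨y, u, v, hyu, hyv, huv, rfl⟩])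
    intro t
    rw [← mem_neighborFinset, ← heq]; simp
  have hpart : ∀ x, ∃ y, x ∈ X → y ∈ X ∧ G.Adj x y ∧ ∀ t ∈ X, G.Adj x t → t = y := by
    intro x
    by_cases hx : x ∈ X
    · obtain ⟨y, u, v, hy, hN, -, hu, hv⟩ := key x hx
      refine ⟨y, fun _ => ⟨hy, (hN y).2 (Or.inl rfl), fun t ht hxt => ?_⟩⟩
      have htD := (Finset.mem_filter.1 ht).1
      rcases (hN t).1 hxt with h | rfl | rfl
      exacts [h, absurd htD hu.1, absurd htD hv.1]
    · exact ⟨x, fun h => absurd h hx⟩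
  have hcen : ∀ ℓ, ∃ x, ℓ ∈ P → x ∈ X ∧ G.Adj ℓ x ∧ ∀ t ∈ D, G.Adj ℓ t → t = x := by
    intro ℓ
    by_cases hℓ : ℓ ∈ P
    · obtain ⟨-, hℓD, x, hx, hadj⟩ := Finset.mem_filter.1 hℓ
      refine ⟨x, fun _ => ⟨hx, hadj, fun t ht hlt => ?_⟩⟩
      obtain ⟨y, u, v, hy, hN, -, hu, hv⟩ := key x hx
      rcases (hN ℓ).1 hadj.symm with rfl | rfl | rfl
      exacts [absurd (Finset.mem_filter.1 hy).1 hℓD, (hu.2 t ht).1 hlt, (hv.2 t ht).1 hlt]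
    · exact ⟨ℓ, fun h => absurd h hℓ⟩
  choose partner hpart using hpart
  choose center hcen using hcen
  have hIX : ∀ z, z ∈ D ↔ z ∈ I ∨ z ∈ X := by
    intro z; simp only [hI, hX, Finset.mem_filter]; tauto
  refine ⟨I, X, P, O, partner, center, ?_, ?_⟩
  · constructor
    · intro v
      by_cases hv : v ∈ D
      · rcases (hIX v).1 hv with h | h <;> tauto
      · by_cases h : ∃ x ∈ X, G.Adj v x
        · exact Or.inr (Or.inr (Or.inl (by simp only [hP, Finset.mem_filter]; simp [hv, h])))
        · exact Or.inr (Or.inr (Or.inr (by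
            simp only [hO, Finset.mem_filter]; exact ⟨by simp, hv, h⟩)))
    · exact (Finset.disjoint_filter_filter_not D D _).symm
    · exact Finset.disjoint_left.2 fun v h h' =>
        (Finset.mem_filter.1 h').2.1 (Finset.mem_filter.1 h).1
    · exact Finset.disjoint_left.2 fun v h h' =>
        (Finset.mem_filter.1 h').2.1 (Finset.mem_filter.1 h).1
    · exact Finset.disjoint_left.2 fun v h h' =>
        (Finset.mem_filter.1 h').2.1 (Finset.mem_filter.1 h).1
    · exact Finset.disjoint_left.2 fun v h h' =>
        (Finset.mem_filter.1 h').2.1 (Finset.mem_filter.1 h).1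
    · exact Finset.disjoint_left.2 fun v h h' =>
        (Finset.mem_filter.1 h').2.2 (Finset.mem_filter.1 h).2.2
    · intro z hz v hzv
      obtain ⟨hzD, hz'⟩ := Finset.mem_filter.1 hz
      have hvD : v ∉ D := fun h => hz' ⟨v, h, hzv⟩
      refine Finset.mem_filter.2 ⟨by simp, hvD, fun hex => ?_⟩
      have hvP : v ∈ P := Finset.mem_filter.2 ⟨by simp, hvD, hex⟩
      obtain ⟨hc, -, h⟩ := hcen v hvP
      have := h z hzD hzv.symm
      subst this
      exact hz' (Finset.mem_filter.1 hc).2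
    · intro x hx w hw hxw
      exact (Finset.mem_filter.1 hw).2.2 ⟨x, hx, hxw.symm⟩
    · intro w hw
      obtain ⟨-, hwD, hw'⟩ := Finset.mem_filter.1 hw
      obtain ⟨z, hz, hwz⟩ := hD w (by simpa using hwD)
      rcases (hIX z).1 hz with h | h
      · exact ⟨z, h, hwz⟩
      · exact absurd ⟨z, h, hwz⟩ hw'
    · exact fun x hx => (hpart x hx).1
    · exact fun x hx => (hpart x hx).2.1
    · exact fun x hx => (hpart x hx).2.2
    · exact fun x hx => (hcen x hx).1
    · exact fun x hx => (hcen x hx).2.1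
    · exact fun x hx t ht => (hcen x hx).2.2 t (Finset.mem_filter.1 ht).1
    · intro ℓ hℓ r hr hlr hadj
      obtain ⟨hc, hadjc, -⟩ := hcen ℓ hℓ
      obtain ⟨-, hadjr, -⟩ := hcen r hr
      rw [← hlr] at hadjr
      obtain ⟨y, u, v, hy, hN, hnuv, hu, hv⟩ := key _ hc
      have hyD := (Finset.mem_filter.1 hy).1
      have hℓD := (Finset.mem_filter.1 hℓ).2.1
      have hrD := (Finset.mem_filter.1 hr).2.1
      have h1 : ℓ ≠ y := by rintro rfl; exact hℓD hyD
      have h2 : r ≠ y := by rintro rfl; exact hrD hyD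
      have h3 := (hN ℓ).1 hadjc.symm
      have h4 := (hN r).1 hadjr.symm
      rcases h3 with h3 | h3 | h3
      · exact h1 h3
      · rcases h4 with h4 | h4 | h4
        · exact h2 h4
        · rw [h3, h4] at hadj; exact G.loopless.irrefl _ hadj
        · rw [h3, h4] at hadj; exact hnuv hadj
      · rcases h4 with h4 | h4 | h4
        · exact h2 h4
        · rw [h3, h4] at hadj; exact hnuv hadj.symm
        · rw [h3, h4] at hadj; exact G.loopless.irrefl _ hadj
  · rw [← hcard, add_comm]
    exact Finset.card_filter_add_card_filter_not _

end Partition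

/-! ### An independent dominating set from a selection and a replaced set. -/

section Construction

variable {V : Type*} [Fintype V] [DecidableEq V] {G : SimpleGraph V} [DecidableRel G.Adj]

theorem HasNoFourCycle.false_of_adj {V : Type*} {G : SimpleGraph V} (hC4 : G.HasNoFourCycle)
    {a b c d : V} (hab : G.Adj a b) (hbc : G.Adj b c) (hcd : G.Adj c d) (hda : G.Adj d a)
    (hac : a ≠ c) (hbd : b ≠ d) : False := by
  refine hC4 a (.cons hab (.cons hbc (.cons hcd (.cons hda .nil)))) ?_ rfl
  have := hab.ne; have := hbc.ne; have := hcd.ne; have := hda.ne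
  simp [Walk.isCycle_def, Walk.isTrail_def]
  grind

namespace IsStarPartition

variable {I X P O : Finset V} {partner center : V → V}

theorem partner_partner (h : G.IsStarPartition I X P O partner center) {x : V} (hx : x ∈ X) :
    partner (partner x) = x :=
  (h.eq_partner _ (h.partner_mem x hx) x hx (h.adj_partner x hx).symm).symm

theorem neighborFinset_outer (h : G.IsStarPartition I X P O partner center) {w : V}
    (hw : w ∈ O) : G.neighborFinset w =
      I.filter (G.Adj w) ∪ P.filter (G.Adj w) ∪ O.filter (G.Adj w) := by
  ext v
  have := h.not_adj_outer v
  have := h.cover v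
  simp only [mem_neighborFinset, Finset.mem_union, Finset.mem_filter]
  constructor
  · intro hwv
    have : v ∉ X := fun hv => h.not_adj_outer v hv w hw hwv.symm
    tauto
  · tauto

theorem card_outer (h : G.IsStarPartition I X P O partner center)
    (hcubic : G.IsRegularOfDegree 3) {w : V} (hw : w ∈ O) :
    (I.filter (G.Adj w)).card + (P.filter (G.Adj w)).card + (O.filter (G.Adj w)).card = 3 := by
  rw [← hcubic w, ← card_neighborFinset_eq_degree, h.neighborFinset_outer hw,
    Finset.card_union_of_disjoint, Finset.card_union_of_disjoint]
  · exact Finset.disjoint_filter_filter h.disj_IP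
  · rw [Finset.disjoint_union_left]
    exact ⟨Finset.disjoint_filter_filter h.disj_outer, Finset.disjoint_filter_filter h.disj_PO⟩

theorem card_isolate (h : G.IsStarPartition I X P O partner center)
    (hcubic : G.IsRegularOfDegree 3) {z : V} (hz : z ∈ I) : (O.filter (G.Adj z)).card = 3 := by
  rw [← hcubic z, ← card_neighborFinset_eq_degree]
  congr 1; ext v
  simp only [Finset.mem_filter, mem_neighborFinset]
  exact ⟨fun h => h.2, fun hv => ⟨h.outer_of_adj z hz v hv, hv⟩⟩

theorem card_leaf (h : G.IsStarPartition I X P O partner center)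
    (hcubic : G.IsRegularOfDegree 3) {ℓ : V} (hℓ : ℓ ∈ P) :
    (P.filter (G.Adj ℓ)).card + (O.filter (G.Adj ℓ)).card = 2 := by
  have hN : G.neighborFinset ℓ =
      insert (center ℓ) (P.filter (G.Adj ℓ) ∪ O.filter (G.Adj ℓ)) := by
    ext v
    simp only [mem_neighborFinset, Finset.mem_insert, Finset.mem_union, Finset.mem_filter]
    constructor
    · intro hlv
      rcases h.cover v with hv | hv | hv | hv
      · exact absurd (h.outer_of_adj v hv ℓ hlv.symm) (Finset.disjoint_left.1 h.disj_PO hℓ)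
      · exact Or.inl (h.eq_center ℓ hℓ v hv hlv)
      · exact Or.inr (Or.inl ⟨hv, hlv⟩)
      · exact Or.inr (Or.inr ⟨hv, hlv⟩)
    · rintro (rfl | hv | hv)
      exacts [h.adj_center ℓ hℓ, hv.2, hv.2]
  have h3 := hcubic ℓ
  have hcX := h.center_mem ℓ hℓ
  rw [← card_neighborFinset_eq_degree, hN, Finset.card_insert_of_notMem,
    Finset.card_union_of_disjoint] at h3
  · omega
  · exact Finset.disjoint_filter_filter h.disj_PO
  · simp only [Finset.mem_union, Finset.mem_filter, not_or, not_and]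
    exact ⟨fun hc => absurd hc (Finset.disjoint_left.1 h.disj_XP hcX),
      fun hc => absurd hc (Finset.disjoint_left.1 h.disj_XO hcX)⟩

theorem card_center_fiber (h : G.IsStarPartition I X P O partner center)
    (hcubic : G.IsRegularOfDegree 3) {x : V} (hx : x ∈ X) :
    (P.filter fun ℓ => center ℓ = x).card = 2 := by
  have hN : G.neighborFinset x = insert (partner x) (P.filter fun ℓ => center ℓ = x) := by
    ext v
    simp only [mem_neighborFinset, Finset.mem_insert, Finset.mem_filter]
    constructor
    · intro hxv
      rcases h.cover v with hv | hv | hv | hv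
      · exact absurd (h.outer_of_adj v hv x hxv.symm) (Finset.disjoint_left.1 h.disj_XO hx)
      · exact Or.inl (h.eq_partner x hx v hv hxv)
      · exact Or.inr ⟨hv, (h.eq_center v hv x hx hxv.symm).symm⟩
      · exact absurd hxv (h.not_adj_outer x hx v hv)
    · rintro (rfl | ⟨hv, rfl⟩)
      exacts [h.adj_partner x hx, (h.adj_center v hv).symm]
  have h3 := hcubic x
  rw [← card_neighborFinset_eq_degree, hN, Finset.card_insert_of_notMem] at h3
  · omega
  · simp only [Finset.mem_filter, not_and]
    exact fun hc => absurd hc (Finset.disjoint_left.1 h.disj_XP (h.partner_mem x hx))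

theorem card_leaves_over (h : G.IsStarPartition I X P O partner center)
    (hcubic : G.IsRegularOfDegree 3) (Y : Finset V) (hY : Y ⊆ X) :
    (P.filter fun ℓ => center ℓ ∈ Y).card = 2 * Y.card := by
  have hmaps : Set.MapsTo center (P.filter fun ℓ => center ℓ ∈ Y : Finset V) (Y : Set V) :=
    fun ℓ hℓ => (Finset.mem_filter.1 (Finset.mem_coe.1 hℓ)).2
  rw [Finset.card_eq_sum_card_fiberwise hmaps, mul_comm, ← smul_eq_mul, ← Finset.sum_const]
  refine Finset.sum_congr rfl fun x hx => ?_
  rw [← h.card_center_fiber hcubic (hY hx), Finset.filter_filter]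
  congr 1; ext ℓ
  simp only [Finset.mem_filter]
  constructor
  · rintro ⟨a, -, b⟩; exact ⟨a, b⟩
  · rintro ⟨a, rfl⟩; exact ⟨a, hx, rfl⟩

theorem card_leaves (h : G.IsStarPartition I X P O partner center)
    (hcubic : G.IsRegularOfDegree 3) : P.card = 2 * X.card := by
  rw [← h.card_leaves_over hcubic X subset_rfl, Finset.filter_true_of_mem h.center_mem]

/-- A choice of one vertex from each pair of partners. -/
def IsSelection (X : Finset V) (partner : V → V) (s : V → ZMod 2) : Prop :=
  ∀ x ∈ X, s (partner x) = s x + 1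

/-- The leaves of the centers that are not selected. -/
def freed (P : Finset V) (center : V → V) (s : V → ZMod 2) : Finset V :=
  P.filter fun ℓ => s (center ℓ) = 0

/-- The value 1 means that a center is kept and 0 that it is dropped; `partner` exchanges the two
classes. -/
theorem card_selected (h : G.IsStarPartition I X P O partner center) {s : V → ZMod 2}
    (hs : IsSelection X partner s) :
    2 * (X.filter fun x => s x = 1).card = X.card ∧
      2 * (X.filter fun x => s x = 0).card = X.card := by
  have h1 : (X.filter fun x => s x = 1).card = (X.filter fun x => s x = 0).card := by
    refine Finset.card_bij' (fun x _ => partner x) (fun x _ => partner x) ?_ ?_ ?_ ?_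
    · intro x hx
      obtain ⟨hx, h1⟩ := Finset.mem_filter.1 hx
      exact Finset.mem_filter.2 ⟨h.partner_mem x hx, by rw [hs x hx, h1]; rfl⟩
    · intro x hx
      obtain ⟨hx, h1⟩ := Finset.mem_filter.1 hx
      exact Finset.mem_filter.2 ⟨h.partner_mem x hx, by rw [hs x hx, h1]; rfl⟩
    · intro x hx; exact h.partner_partner (Finset.mem_filter.1 hx).1
    · intro x hx; exact h.partner_partner (Finset.mem_filter.1 hx).1
  have h2 := Finset.card_filter_add_card_filter_not (s := X) (fun x => s x = 1)
  have h3 : (X.filter fun x => ¬ s x = 1) = X.filter fun x => s x = 0 := by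
    refine Finset.filter_congr fun x _ => ?_
    generalize s x = a; revert a; decide
  rw [h3] at h2
  omega

theorem card_freed (h : G.IsStarPartition I X P O partner center)
    (hcubic : G.IsRegularOfDegree 3) {s : V → ZMod 2} (hs : IsSelection X partner s) :
    (freed P center s).card = X.card := by
  rw [← (h.card_selected hs).2, ← h.card_leaves_over hcubic _ (Finset.filter_subset _ _)]
  congr 1; ext ℓ
  simp only [freed, Finset.mem_filter]
  constructor
  · rintro ⟨a, b⟩; exact ⟨a, h.center_mem ℓ a, b⟩
  · rintro ⟨a, -, b⟩; exact ⟨a, b⟩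

end IsStarPartition

variable (G) in
/-- The leaves without a neighbouring leaf. -/
def loneLeaves (P : Finset V) : Finset V := G.isolatedIn P

variable (G) in
/-- The vertices of `I` that are the only neighbour in `I` of some outer neighbour of `ℓ`. -/
def owners (I O : Finset V) (ℓ : V) : Finset V :=
  I.filter fun z => ∃ w ∈ O, G.Adj ℓ w ∧ ∀ y ∈ I, G.Adj w y ↔ y = z

variable (G) in
/-- The cost of replacing `z` by its outer neighbours, each shared among its neighbours in `I`. -/
def replacementCost (I O : Finset V) (z : V) : ℚ :=
  ∑ w ∈ O.filter (G.Adj z), 1 / ((I.filter (G.Adj w)).card : ℚ) - 1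

theorem independentDominationNumber_le {V : Type*} {G : SimpleGraph V} {S : Finset V}
    (hS : G.IsDominatingSet (S : Set V)) (hS' : G.IsIndepSet (S : Set V)) :
    G.independentDominationNumber ≤ S.card := Nat.sInf_le ⟨S, hS, hS', rfl⟩

namespace IsStarPartition

variable {I X P O : Finset V} {partner center : V → V}

/-- An outer vertex counted on the left has all its neighbours in `I` inside `Z`, so the equal
shares it gives them add up to 1. -/
theorem card_le_sum_replacementCost (h : G.IsStarPartition I X P O partner center)
    {Z : Finset V} (hZ : Z ⊆ I) :
    ((O.filter fun w => ∀ z ∈ I, G.Adj w z → z ∈ Z).card : ℚ) ≤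
      ∑ z ∈ Z, G.replacementCost I O z + Z.card := by
  have h1 : ∑ z ∈ Z, G.replacementCost I O z + Z.card =
      ∑ w ∈ O, ∑ z ∈ Z.filter (G.Adj w), 1 / ((I.filter (G.Adj w)).card : ℚ) := by
    simp only [replacementCost, Finset.sum_sub_distrib]
    rw [Finset.sum_const, nsmul_eq_mul, mul_one, sub_add_cancel]
    refine Finset.sum_comm' fun z w => ?_
    simp only [Finset.mem_filter, G.adj_comm]
    tauto
  rw [h1, Finset.card_eq_sum_ones, Nat.cast_sum]
  refine (Finset.sum_le_sum fun w hw => ?_).trans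
    (Finset.sum_le_sum_of_subset_of_nonneg (Finset.filter_subset _ _) fun w _ _ =>
      Finset.sum_nonneg fun z _ => by positivity)
  obtain ⟨hwO, hw⟩ := Finset.mem_filter.1 hw
  have hEq : Z.filter (G.Adj w) = I.filter (G.Adj w) := by
    ext z; simp only [Finset.mem_filter]
    exact ⟨fun hz => ⟨hZ hz.1, hz.2⟩, fun hz => ⟨hw z hz.1 hz.2, hz.2⟩⟩
  obtain ⟨z, hz, hwz⟩ := h.exists_isolate w hwO
  have hpos : 0 < (I.filter (G.Adj w)).card := Finset.card_pos.2 ⟨z, by simp [hz, hwz]⟩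
  rw [hEq, Finset.sum_const, nsmul_eq_mul]
  have : ((I.filter (G.Adj w)).card : ℚ) ≠ 0 := by positivity
  rw [mul_one_div_cancel this]; simp

/-- Removing the leaves adjacent to `W` from `U` isolates few new leaves. -/
theorem card_isolatedIn_uncovered (h : G.IsStarPartition I X P O partner center)
    (hcubic : G.IsRegularOfDegree 3) {U W : Finset V} (hU : U ⊆ P) (hW : W ⊆ O) :
    (U.filter fun ℓ => ∀ w ∈ W, ¬ G.Adj ℓ w).card +
      (G.isolatedIn (U.filter fun ℓ => ∀ w ∈ W, ¬ G.Adj ℓ w)).card +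
      2 * ((G.loneLeaves P ∩ U).filter fun ℓ => ∃ w ∈ W, G.Adj ℓ w).card ≤
      U.card + (G.isolatedIn U).card := by
  set T := U.filter fun ℓ => ∀ w ∈ W, ¬ G.Adj ℓ w with hT
  set cA := (G.loneLeaves P ∩ U).filter fun ℓ => ∃ w ∈ W, G.Adj ℓ w with hcA
  set cB := (U \ G.loneLeaves P).filter fun ℓ => ∃ w ∈ W, G.Adj ℓ w with hcB
  have hcount : T.card + (cA.card + cB.card) = U.card := by
    rw [← Finset.card_filter_add_card_filter_not (s := U) (fun ℓ => ∀ w ∈ W, ¬ G.Adj ℓ w), ← hT,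
      ← Finset.card_union_of_disjoint]
    · congr 2; ext ℓ
      simp only [hcA, hcB, Finset.mem_union, Finset.mem_filter, Finset.mem_inter,
        Finset.mem_sdiff, not_forall, not_not, exists_prop]
      by_cases ℓ ∈ G.loneLeaves P <;> simp [*]
    · rw [Finset.disjoint_left]
      intro a ha hb
      simp only [hcA, hcB, Finset.mem_filter, Finset.mem_inter, Finset.mem_sdiff] at ha hb
      exact hb.1.2 ha.1.1
  -- A covered lone leaf is lost from both `U` and its isolated vertices, hence the factor 2 in the
  -- statement.
  have hold : (G.isolatedIn T ∩ G.isolatedIn U).card + cA.card ≤ (G.isolatedIn U).card := by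
    rw [← Finset.card_union_of_disjoint]
    · refine Finset.card_le_card fun ℓ hℓ => ?_
      rcases Finset.mem_union.1 hℓ with hℓ | hℓ
      · exact (Finset.mem_inter.1 hℓ).2
      · simp only [hcA, loneLeaves, isolatedIn, Finset.mem_filter, Finset.mem_inter] at hℓ ⊢
        exact ⟨hℓ.1.2, fun u hu => hℓ.1.1.2 u (hU hu)⟩
    · rw [Finset.disjoint_left]
      intro a ha hb
      simp only [hcA, isolatedIn, hT, Finset.mem_filter, Finset.mem_inter] at ha hb
      obtain ⟨w, hw, haw⟩ := hb.2
      exact ha.1.1.2 w hw haw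
  -- A newly isolated leaf lost a neighbour in `cB`. A leaf in `cB` has an outer neighbour besides
  -- its center, so it has at most one neighbour in `P` to isolate.
  have hnew : (G.isolatedIn T \ G.isolatedIn U).card ≤ cB.card := by
    refine Finset.card_le_card_of_forall_subsingleton (fun a b => G.Adj a b) ?_ ?_
    · intro a ha
      simp only [isolatedIn, Finset.mem_sdiff, Finset.mem_filter, not_and] at ha
      have haU := (Finset.mem_filter.1 ha.1.1).1
      have hex := ha.2 haU
      push Not at hex
      obtain ⟨b, hb, hab⟩ := hex
      refine ⟨b, ?_, hab⟩
      have hbT : b ∉ T := fun hbT => ha.1.2 b hbT hab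
      have hbW : ∃ w ∈ W, G.Adj b w := by
        by_contra! hno
        exact hbT (Finset.mem_filter.2 ⟨hb, hno⟩)
      refine Finset.mem_filter.2 ⟨Finset.mem_sdiff.2 ⟨hb, fun hbA => ?_⟩, hbW⟩
      exact (mem_isolatedIn.1 hbA).2 a (hU haU) hab.symm
    · intro b hb a ha a' ha'
      simp only [Set.mem_ofPred_eq] at ha ha'
      obtain ⟨hbU, w, hw, hbw⟩ := Finset.mem_filter.1 hb
      have hbP : b ∈ P := hU (Finset.mem_sdiff.1 hbU).1
      have hsub : ∀ c, c ∈ G.isolatedIn T \ G.isolatedIn U → c ∈ P := fun c hc =>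
        hU (Finset.mem_filter.1 (mem_isolatedIn.1 (Finset.mem_sdiff.1 hc).1).1).1
      have hO : 1 ≤ (O.filter (G.Adj b)).card :=
        Finset.card_pos.2 ⟨w, Finset.mem_filter.2 ⟨hW hw, hbw⟩⟩
      have hP : (P.filter (G.Adj b)).card ≤ 1 := by
        have := h.card_leaf hcubic hbP
        omega
      exact Finset.card_le_one.1 hP a (Finset.mem_filter.2 ⟨hsub a ha.1, ha.2.symm⟩) a'
        (Finset.mem_filter.2 ⟨hsub a' ha'.1, ha'.2.symm⟩)
  have hsplit := Finset.card_inter_add_card_sdiff (G.isolatedIn T) (G.isolatedIn U)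
  omega

/-- A dropped outer vertex covers at most one leaf. -/
theorem card_owned_le (h : G.IsStarPartition I X P O partner center)
    (hcubic : G.IsRegularOfDegree 3) {L W Z : Finset V} (hL : L ⊆ P)
    (hWR : W ⊆ O.filter fun w => ∀ z ∈ I, G.Adj w z → z ∈ Z)
    (hdom : ∀ v ∈ O.filter (fun w => ∀ z ∈ I, G.Adj w z → z ∈ Z), v ∉ W → ∃ u ∈ W, G.Adj v u) :
    (L.filter fun ℓ => (G.owners I O ℓ ∩ Z).Nonempty).card + W.card ≤
      (L.filter fun ℓ => ∃ w ∈ W, G.Adj ℓ w).card +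
        (O.filter fun w => ∀ z ∈ I, G.Adj w z → z ∈ Z).card := by
  set R := O.filter fun w => ∀ z ∈ I, G.Adj w z → z ∈ Z with hR
  set p := L.filter fun ℓ => (G.owners I O ℓ ∩ Z).Nonempty with hp
  set c := L.filter fun ℓ => ∃ w ∈ W, G.Adj ℓ w with hc
  -- A dropped outer vertex has a neighbour in `W` and one in `I`, so only one edge remains for a
  -- leaf.
  have h1 : (p \ c).card ≤ (R \ W).card := by
    refine Finset.card_le_card_of_forall_subsingleton (fun a b => G.Adj a b) ?_ ?_
    · intro ℓ hℓ
      obtain ⟨hℓp, hℓc⟩ := Finset.mem_sdiff.1 hℓ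
      obtain ⟨hℓL, z, hz⟩ := Finset.mem_filter.1 hℓp
      obtain ⟨hzo, hzZ⟩ := Finset.mem_inter.1 hz
      obtain ⟨hzI, w, hw, hlw, hwz⟩ := Finset.mem_filter.1 hzo
      refine ⟨w, Finset.mem_sdiff.2 ⟨Finset.mem_filter.2 ⟨hw, fun y hy hwy => ?_⟩, fun hwW => ?_⟩,
        hlw⟩
      · rw [(hwz y hy).1 hwy]; exact hzZ
      · exact hℓc (Finset.mem_filter.2 ⟨hℓL, w, hwW, hlw⟩)
    · intro w hw a ha a' ha'
      simp only [Set.mem_ofPred_eq] at ha ha'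
      obtain ⟨hwR, hwW⟩ := Finset.mem_sdiff.1 hw
      have hwO := (Finset.mem_filter.1 hwR).1
      obtain ⟨u, hu, hwu⟩ := hdom w hwR hwW
      obtain ⟨z, hz, hwz⟩ := h.exists_isolate w hwO
      have hI : 1 ≤ (I.filter (G.Adj w)).card :=
        Finset.card_pos.2 ⟨z, Finset.mem_filter.2 ⟨hz, hwz⟩⟩
      have hO : 1 ≤ (O.filter (G.Adj w)).card :=
        Finset.card_pos.2 ⟨u, Finset.mem_filter.2 ⟨(Finset.mem_filter.1 (hWR hu)).1, hwu⟩⟩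
      have hP : (P.filter (G.Adj w)).card ≤ 1 := by
        have := h.card_outer hcubic hwO
        omega
      have hsub : ∀ b, b ∈ p \ c → b ∈ P := fun b hb =>
        hL (Finset.mem_filter.1 (Finset.mem_sdiff.1 hb).1).1
      exact Finset.card_le_one.1 hP a (Finset.mem_filter.2 ⟨hsub a ha.1, ha.2.symm⟩) a'
        (Finset.mem_filter.2 ⟨hsub a' ha'.1, ha'.2.symm⟩)
  have h2 := Finset.card_sdiff_add_card_eq_card hWR
  have h3 : p.card ≤ (p \ c).card + c.card := by
    have := Finset.card_le_card_sdiff_add_card (s := p) (t := c)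
    omega
  omega

/-- The independent dominating set obtained by keeping the selected centers and replacing `Z`. -/
theorem independentDominationNumber_le_of_selection
    (h : G.IsStarPartition I X P O partner center) (hcubic : G.IsRegularOfDegree 3)
    {s : V → ZMod 2} (hs : IsSelection X partner s) {Z : Finset V} (hZ : Z ⊆ I)
    (hZpriv : ∀ z ∈ Z, ∃ w ∈ O, G.Adj z w ∧ (∀ v ∈ O, ¬ G.Adj w v) ∧
      ∀ y ∈ I, G.Adj w y → y = z) :
    (G.independentDominationNumber : ℚ) ≤ I.card + X.card / 2 +
      ((freed P center s).card + (G.isolatedIn (freed P center s)).card) / 2 +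
      ∑ z ∈ Z, G.replacementCost I O z -
      ((G.loneLeaves P ∩ freed P center s).filter fun ℓ =>
        (G.owners I O ℓ ∩ Z).Nonempty).card := by
  set U := freed P center s with hUdef
  have hU : U ⊆ P := Finset.filter_subset _ _
  obtain ⟨W, hWR, hWind, hWdom⟩ :=
    G.exists_indep_subset_dominating (O.filter fun w => ∀ z ∈ I, G.Adj w z → z ∈ Z)
  have hWO : W ⊆ O := hWR.trans (Finset.filter_subset _ _)
  set T := U.filter fun ℓ => ∀ w ∈ W, ¬ G.Adj ℓ w with hT
  have hTP : T ⊆ P := (Finset.filter_subset _ _).trans hU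
  obtain ⟨M, hMT, hMind, hMdom, hMcard⟩ := G.exists_indep_subset_dominating_card_le T (by
    intro ℓ hℓ
    have := h.card_leaf hcubic (hTP hℓ)
    have := Finset.card_le_card (Finset.filter_subset_filter (G.Adj ℓ) hTP)
    omega)
  set C := X.filter fun x => s x = 1 with hC
  have hCX : C ⊆ X := Finset.filter_subset _ _
  have hdom : G.IsDominatingSet (((I \ Z) ∪ C ∪ W ∪ M : Finset V) : Set V) := by
    intro v hv
    simp only [Finset.mem_coe, Finset.mem_union, not_or] at hv ⊢
    obtain ⟨⟨⟨hvI, hvC⟩, hvW⟩, hvM⟩ := hv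
    rcases h.cover v with hv | hv | hv | hv
    · have hvZ : v ∈ Z := by
        by_contra hvZ; exact hvI (Finset.mem_sdiff.2 ⟨hv, hvZ⟩)
      -- Having no outer neighbour, `w` must belong to `W`; thus a removed `v` stays dominated.
      obtain ⟨w, hw, hvw, hwO, hwI⟩ := hZpriv v hvZ
      have hwR : w ∈ O.filter fun w => ∀ z ∈ I, G.Adj w z → z ∈ Z :=
        Finset.mem_filter.2 ⟨hw, fun y hy hwy => by rw [hwI y hy hwy]; exact hvZ⟩
      refine ⟨w, Or.inl (Or.inr ?_), hvw⟩
      by_contra hwW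
      obtain ⟨u, hu, hwu⟩ := hWdom w hwR hwW
      exact hwO u (hWO hu) hwu
    · refine ⟨partner v, Or.inl (Or.inl (Or.inr ?_)), h.adj_partner v hv⟩
      have hsv : s v ≠ 1 := fun h1 => hvC (Finset.mem_filter.2 ⟨hv, h1⟩)
      refine Finset.mem_filter.2 ⟨h.partner_mem v hv, ?_⟩
      rw [hs v hv]
      revert hsv; generalize s v = a; revert a; decide
    · by_cases hvU : v ∈ U
      · by_cases hvT : v ∈ T
        · obtain ⟨u, hu, hvu⟩ := hMdom v hvT hvM
          exact ⟨u, Or.inr hu, hvu⟩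
        · have : ∃ w ∈ W, G.Adj v w := by
            by_contra! hno; exact hvT (Finset.mem_filter.2 ⟨hvU, hno⟩)
          obtain ⟨w, hw, hvw⟩ := this
          exact ⟨w, Or.inl (Or.inr hw), hvw⟩
      · refine ⟨center v, Or.inl (Or.inl (Or.inr ?_)), h.adj_center v hv⟩
        have hsv : s (center v) ≠ 0 := fun h1 => hvU (Finset.mem_filter.2 ⟨hv, h1⟩)
        refine Finset.mem_filter.2 ⟨h.center_mem v hv, ?_⟩
        revert hsv; generalize s (center v) = a; revert a; decide
    · by_cases hvR : ∀ z ∈ I, G.Adj v z → z ∈ Z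
      · obtain ⟨w, hw, hvw⟩ := hWdom v (Finset.mem_filter.2 ⟨hv, hvR⟩) hvW
        exact ⟨w, Or.inl (Or.inr hw), hvw⟩
      · push Not at hvR
        obtain ⟨z, hz, hvz, hzZ⟩ := hvR
        exact ⟨z, Or.inl (Or.inl (Or.inl (Finset.mem_sdiff.2 ⟨hz, hzZ⟩))), hvz⟩
  have hind : G.IsIndepSet (((I \ Z) ∪ C ∪ W ∪ M : Finset V) : Set V) := by
    have hII : ∀ a ∈ I, ∀ b ∈ I, ¬ G.Adj a b := fun a ha b hb hab =>
      Finset.disjoint_left.1 h.disj_outer hb (h.outer_of_adj a ha b hab)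
    have hIX : ∀ a ∈ I, ∀ b ∈ X, ¬ G.Adj a b := fun a ha b hb hab =>
      Finset.disjoint_left.1 h.disj_XO hb (h.outer_of_adj a ha b hab)
    have hIP : ∀ a ∈ I, ∀ b ∈ P, ¬ G.Adj a b := fun a ha b hb hab =>
      Finset.disjoint_left.1 h.disj_PO hb (h.outer_of_adj a ha b hab)
    have hIW : ∀ a ∈ I \ Z, ∀ b ∈ W, ¬ G.Adj a b := fun a ha b hb hab =>
      (Finset.mem_sdiff.1 ha).2
        ((Finset.mem_filter.1 (hWR hb)).2 a (Finset.mem_sdiff.1 ha).1 hab.symm)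
    have hCC : ∀ a ∈ C, ∀ b ∈ C, ¬ G.Adj a b := by
      intro a ha b hb hab
      obtain ⟨haX, ha1⟩ := Finset.mem_filter.1 ha
      obtain ⟨hbX, hb1⟩ := Finset.mem_filter.1 hb
      have := hs a haX
      rw [← h.eq_partner a haX b hbX hab, ha1, hb1] at this
      exact absurd this (by decide)
    have hCM : ∀ a ∈ C, ∀ b ∈ M, ¬ G.Adj a b := by
      intro a ha b hb hab
      obtain ⟨haX, ha1⟩ := Finset.mem_filter.1 ha
      obtain ⟨hbP, hb0⟩ := Finset.mem_filter.1 (Finset.mem_filter.1 (hMT hb)).1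
      rw [← h.eq_center b hbP a haX hab.symm, ha1] at hb0
      exact absurd hb0 (by decide)
    have hWM : ∀ a ∈ M, ∀ b ∈ W, ¬ G.Adj a b := fun a ha b hb =>
      (Finset.mem_filter.1 (hMT ha)).2 b hb
    have hWW : ∀ a ∈ W, ∀ b ∈ W, ¬ G.Adj a b := fun a ha b hb hab =>
      hWind (Finset.mem_coe.2 ha) (Finset.mem_coe.2 hb) hab.ne hab
    have hMM : ∀ a ∈ M, ∀ b ∈ M, ¬ G.Adj a b := fun a ha b hb hab =>
      hMind (Finset.mem_coe.2 ha) (Finset.mem_coe.2 hb) hab.ne hab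
    have hI' : ∀ a ∈ I \ Z, a ∈ I := fun a ha => (Finset.mem_sdiff.1 ha).1
    intro a ha b hb _ hab
    simp only [Finset.mem_coe, Finset.mem_union] at ha hb
    rcases ha with ((ha | ha) | ha) | ha <;> rcases hb with ((hb | hb) | hb) | hb
    · exact hII a (hI' a ha) b (hI' b hb) hab
    · exact hIX a (hI' a ha) b (hCX hb) hab
    · exact hIW a ha b hb hab
    · exact hIP a (hI' a ha) b (hTP (hMT hb)) hab
    · exact hIX b (hI' b hb) a (hCX ha) hab.symm
    · exact hCC a ha b hb hab
    · exact h.not_adj_outer a (hCX ha) b (hWO hb) hab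
    · exact hCM a ha b hb hab
    · exact hIW b hb a ha hab.symm
    · exact h.not_adj_outer b (hCX hb) a (hWO ha) hab.symm
    · exact hWW a ha b hb hab
    · exact hWM b hb a ha hab.symm
    · exact hIP b (hI' b hb) a (hTP (hMT ha)) hab.symm
    · exact hCM b hb a ha hab.symm
    · exact hWM a ha b hb hab
    · exact hMM a ha b hb hab
  have h0 := independentDominationNumber_le hdom hind
  have h1 : ((I \ Z) ∪ C ∪ W ∪ M).card ≤ (I \ Z).card + C.card + W.card + M.card := by
    have := Finset.card_union_le ((I \ Z) ∪ C ∪ W) M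
    have := Finset.card_union_le ((I \ Z) ∪ C) W
    have := Finset.card_union_le (I \ Z) C
    omega
  have h2 := Finset.card_sdiff_add_card_eq_card hZ
  have h3 := (h.card_selected hs).1
  have h4 := h.card_isolatedIn_uncovered hcubic hU hWO
  have h5 := h.card_owned_le hcubic (L := G.loneLeaves P ∩ U)
    (Finset.inter_subset_right.trans hU) hWR hWdom
  have h6 := h.card_le_sum_replacementCost hZ
  rw [← hT] at h4
  rw [← hC] at h3
  have h7 := h0.trans h1
  qify at h2 h3 h4 h5 h7 hMcard
  linarith

end IsStarPartition

end Construction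

/-! ### Expected savings over selections and replacements. -/

section Averaging

variable {V : Type*} [Fintype V] [DecidableEq V] {G : SimpleGraph V} [DecidableRel G.Adj]

variable (G) in
/-- The number of lone leaves adjacent to outer neighbours of `z`, where each outer neighbour
is shared among its neighbours in `I`. -/
def leafShare (I P O : Finset V) (z : V) : ℚ :=
  ∑ w ∈ O.filter (G.Adj z),
    (((G.loneLeaves P).filter (G.Adj w)).card : ℚ) / ((I.filter (G.Adj w)).card : ℚ)

variable (G) in
/-- The number of freed lone leaves owned by `z`. -/
def ownedCount (I P O : Finset V) (center : V → V) (s : V → ZMod 2) (z : V) : ℕ :=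
  ((G.loneLeaves P ∩ IsStarPartition.freed P center s).filter fun ℓ => z ∈ G.owners I O ℓ).card

variable (G) in
/-- The expected gain of replacing `z` with probability `1/3`, when this is worthwhile. -/
def replacementGain (I P O : Finset V) (center : V → V) (s : V → ZMod 2) (z : V) : ℚ :=
  if 4 < G.leafShare I P O z then
    max 0 (5 / 18 * (G.ownedCount I P O center s z : ℚ) - G.replacementCost I O z / 3) else 0

namespace IsStarPartition

variable {I X P O : Finset V} {partner center : V → V}

theorem card_owners_le (h : G.IsStarPartition I X P O partner center)
    (hcubic : G.IsRegularOfDegree 3) {ℓ : V} (hℓ : ℓ ∈ P) : (G.owners I O ℓ).card ≤ 2 := by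
  have h1 : (G.owners I O ℓ).card ≤ (O.filter (G.Adj ℓ)).card := by
    refine Finset.card_le_card_of_forall_subsingleton
      (fun z w => ∀ y ∈ I, G.Adj w y ↔ y = z) ?_ ?_
    · intro z hz
      obtain ⟨-, w, hw, hlw, hwz⟩ := Finset.mem_filter.1 hz
      exact ⟨w, Finset.mem_filter.2 ⟨hw, hlw⟩, hwz⟩
    · intro w _ z hz z' hz'
      have hzI := (Finset.mem_filter.1 hz.1).1
      exact (hz'.2 z hzI).1 ((hz.2 z hzI).2 rfl)
  have := h.card_leaf hcubic hℓ
  omega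

theorem leafCount_bounds (h : G.IsStarPartition I X P O partner center)
    (hcubic : G.IsRegularOfDegree 3) {w : V} (hw : w ∈ O) :
    1 ≤ (I.filter (G.Adj w)).card ∧
    (I.filter (G.Adj w)).card + ((G.loneLeaves P).filter (G.Adj w)).card +
      (O.filter (G.Adj w)).card ≤ 3 := by
  obtain ⟨z, hz, hwz⟩ := h.exists_isolate w hw
  refine ⟨Finset.card_pos.2 ⟨z, Finset.mem_filter.2 ⟨hz, hwz⟩⟩, ?_⟩
  have h1 := h.card_outer hcubic hw
  have h2 : ((G.loneLeaves P).filter (G.Adj w)).card ≤ (P.filter (G.Adj w)).card :=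
    Finset.card_le_card (Finset.filter_subset_filter _ fun ℓ hℓ => (mem_isolatedIn.1 hℓ).1)
  omega

/-- The contribution of one outer vertex with `d` neighbours in `I` and `a` lone leaves. -/
theorem share_cases {d a : ℕ} (hd : 1 ≤ d) (hda : d + a ≤ 3) :
    (d = 1 ∧ a ≤ 2) ∨ (2 ≤ d ∧ ((a : ℚ) / d = 1 / 2 ∧ (1 : ℚ) / d = 1 / 2 ∨ (a : ℚ) / d = 0)) := by
  have : d ≤ 3 := by omega
  interval_cases d
  · left; omega
  · right; refine ⟨le_rfl, ?_⟩
    have : a ≤ 1 := by omega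
    interval_cases a <;> norm_num
  · right; refine ⟨by norm_num, ?_⟩
    have : a = 0 := by omega
    subst this; norm_num

/-- An outer neighbour without these properties contributes at most 1 to the share, and there are
only three. A share above 4 therefore makes replacing `z` admissible. -/
theorem exists_private_outer (h : G.IsStarPartition I X P O partner center)
    (hcubic : G.IsRegularOfDegree 3) {z : V} (hz : z ∈ I) (ha : 4 < G.leafShare I P O z) :
    ∃ w ∈ O, G.Adj z w ∧ (∀ v ∈ O, ¬ G.Adj w v) ∧ ∀ y ∈ I, G.Adj w y → y = z := by
  by_contra! hno
  have hle : ∀ w ∈ O.filter (G.Adj z),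
      (((G.loneLeaves P).filter (G.Adj w)).card : ℚ) / ((I.filter (G.Adj w)).card : ℚ) ≤ 1 := by
    intro w hw
    obtain ⟨hwO, hzw⟩ := Finset.mem_filter.1 hw
    obtain ⟨h1, h2⟩ := h.leafCount_bounds hcubic hwO
    rcases share_cases (a := ((G.loneLeaves P).filter (G.Adj w)).card) h1 (by omega) with
      ⟨hd, -⟩ | ⟨-, h3 | h3⟩
    · have hO : 1 ≤ (O.filter (G.Adj w)).card := by
        by_contra! hlt
        have hempty := Finset.card_eq_zero.1 (Nat.lt_one_iff.1 hlt)
        obtain ⟨y, hy, hwy, hyz⟩ := hno w hwO hzw fun v hv hwv => by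
          have : v ∈ O.filter (G.Adj w) := Finset.mem_filter.2 ⟨hv, hwv⟩
          rw [hempty] at this
          exact absurd this (Finset.notMem_empty _)
        exact hyz (Finset.card_le_one.1 hd.le y (Finset.mem_filter.2 ⟨hy, hwy⟩) z
          (Finset.mem_filter.2 ⟨hz, hzw.symm⟩))
      rw [hd]
      have : ((G.loneLeaves P).filter (G.Adj w)).card ≤ 1 := by omega
      simpa using this
    · rw [h3.1]; norm_num
    · rw [h3]; norm_num
  have h1 := Finset.sum_le_card_nsmul _ _ _ hle
  rw [h.card_isolate hcubic hz] at h1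
  unfold leafShare at ha
  norm_num at h1
  linarith

/-- A leaf adjacent to two outer neighbours of `z` would close a 4-cycle, so no leaf is counted
twice. -/
theorem card_owned (h : G.IsStarPartition I X P O partner center) (hC4 : G.HasNoFourCycle)
    {z : V} (hz : z ∈ I) :
    ((G.loneLeaves P).filter fun ℓ => z ∈ G.owners I O ℓ).card =
      ∑ w ∈ O.filter (G.Adj z), if (I.filter (G.Adj w)).card = 1 then
        ((G.loneLeaves P).filter (G.Adj w)).card else 0 := by
  rw [← Finset.sum_filter, ← Finset.card_biUnion]
  · congr 1; ext ℓ
    simp only [Finset.mem_filter, Finset.mem_biUnion, owners]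
    constructor
    · rintro ⟨hℓ, -, w, hw, hlw, hwz⟩
      refine ⟨w, ⟨⟨hw, ((hwz z hz).2 rfl).symm⟩, Finset.card_eq_one.2 ⟨z, ?_⟩⟩, hℓ, hlw.symm⟩
      ext y
      simp only [Finset.mem_filter, Finset.mem_singleton]
      constructor
      · rintro ⟨hy, hwy⟩; exact (hwz y hy).1 hwy
      · rintro rfl; exact ⟨hz, (hwz _ hz).2 rfl⟩
    · rintro ⟨w, ⟨⟨hw, hzw⟩, hcard⟩, hℓ, hwl⟩
      refine ⟨hℓ, hz, w, hw, hwl.symm, fun y hy => ⟨fun hwy => ?_, ?_⟩⟩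
      · exact Finset.card_le_one.1 hcard.le y (Finset.mem_filter.2 ⟨hy, hwy⟩) z
          (Finset.mem_filter.2 ⟨hz, hzw.symm⟩)
      · rintro rfl; exact hzw.symm
  · intro w hw w' hw' hne
    rw [Function.onFun, Finset.disjoint_left]
    intro ℓ hℓ hℓ'
    have hw := (Finset.mem_filter.1 (Finset.mem_filter.1 hw).1).2
    have hw' := (Finset.mem_filter.1 (Finset.mem_filter.1 hw').1).2
    obtain ⟨hℓP, hwl⟩ := Finset.mem_filter.1 hℓ
    have hwl' := (Finset.mem_filter.1 hℓ').2
    refine hC4.false_of_adj hw hwl hwl'.symm hw'.symm ?_ hne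
    rintro rfl
    exact Finset.disjoint_left.1 h.disj_IP hz (mem_isolatedIn.1 hℓP).1

/-- Here `m` and `n` are the owned lone leaves freed by a selection and by its complement. A share
above 4 leaves few types: three outer neighbours private to `z`, or two private ones with two lone
leaves each and a third contributing 1/2. -/
theorem gain_pair_bound (h : G.IsStarPartition I X P O partner center)
    (hcubic : G.IsRegularOfDegree 3) (hC4 : G.HasNoFourCycle) {z : V} (hz : z ∈ I)
    (ha : 4 < G.leafShare I P O z) {m n : ℕ}
    (hmn : m + n = ((G.loneLeaves P).filter fun ℓ => z ∈ G.owners I O ℓ).card) :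
    (G.leafShare I P O z - 4) / 8 ≤
      max 0 (5 / 18 * (m : ℚ) - G.replacementCost I O z / 3) +
        max 0 (5 / 18 * (n : ℚ) - G.replacementCost I O z / 3) := by
  rw [h.card_owned hC4 hz] at hmn
  have hb : ∀ w ∈ O.filter (G.Adj z), _ := fun w hw =>
    h.leafCount_bounds hcubic (Finset.mem_filter.1 hw).1
  obtain ⟨u, v, w, huv, huw, hvw, hN⟩ := Finset.card_eq_three.1 (h.card_isolate hcubic hz)
  unfold leafShare replacementCost at *
  rw [hN] at hb ha hmn ⊢
  have hsum : ∀ {M : Type} [AddCommMonoid M] (f : V → M), ∑ t ∈ ({u, v, w} : Finset V), f t =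
      f u + (f v + f w) := by
    intro M _ f
    rw [Finset.sum_insert (by simp [huv, huw]), Finset.sum_pair hvw]
  simp only [hsum] at ha hmn ⊢
  have hu := hb u (by simp)
  have hv := hb v (by simp)
  have hw := hb w (by simp)
  generalize (I.filter (G.Adj u)).card = d₁ at *
  generalize (I.filter (G.Adj v)).card = d₂ at *
  generalize (I.filter (G.Adj w)).card = d₃ at *
  generalize ((G.loneLeaves P).filter (G.Adj u)).card = a₁ at *
  generalize ((G.loneLeaves P).filter (G.Adj v)).card = a₂ at *
  generalize ((G.loneLeaves P).filter (G.Adj w)).card = a₃ at *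
  have cu := share_cases (a := a₁) hu.1 (by omega)
  have cv := share_cases (a := a₂) hv.1 (by omega)
  have cw := share_cases (a := a₃) hw.1 (by omega)
  clear hu hv hw hb
  have hmn' : (m : ℚ) + n = ((m + n : ℕ) : ℚ) := by push_cast; rfl
  rw [hmn] at hmn'
  set c : ℚ := 1 / (d₁ : ℚ) + (1 / (d₂ : ℚ) + 1 / (d₃ : ℚ)) - 1 with hc
  have m0 := le_max_left 0 (5 / 18 * (m : ℚ) - c / 3)
  have m1 := le_max_right 0 (5 / 18 * (m : ℚ) - c / 3)
  have n0 := le_max_left 0 (5 / 18 * (n : ℚ) - c / 3)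
  have n1 := le_max_right 0 (5 / 18 * (n : ℚ) - c / 3)
  have four : ∀ a b : ℕ, a ≤ 2 → b ≤ 2 → (4 : ℚ) < a + b + 1 / 2 → (a : ℚ) + b = 4 := by
    intro a b ha hb hab
    have : 4 ≤ a + b := by
      by_contra! hlt
      have : (a : ℚ) + b ≤ 3 := by exact_mod_cast (by omega : a + b ≤ 3)
      linarith
    exact_mod_cast (by omega : a + b = 4)
  have cast_le : ∀ {a : ℕ}, a ≤ 2 → (a : ℚ) ≤ 2 := fun ha => by exact_mod_cast ha
  rcases cu with ⟨rfl, hu⟩ | ⟨hd₁, hu⟩ <;> rcases cv with ⟨rfl, hv⟩ | ⟨hd₂, hv⟩ <;>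
    rcases cw with ⟨rfl, hw⟩ | ⟨hd₃, hw⟩
  · simp only [if_true, Nat.cast_one, div_one, Nat.cast_add] at *
    have hH : 5 ≤ a₁ + (a₂ + a₃) := by exact_mod_cast ha
    -- The cost is 2. With five leaves one side has at least three, gaining `15/18 - 2/3 = 1/6 ≥
    -- 1/8`; with six the two sides gain at least `30/18 - 4/3 = 1/3 ≥ 1/4`.
    rcases Nat.lt_or_ge (a₁ + (a₂ + a₃)) 6 with h6 | h6
    · have h5 : (a₁ : ℚ) + (a₂ + a₃) = 5 := by
        exact_mod_cast (by omega : a₁ + (a₂ + a₃) = 5)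
      rcases (by omega : 3 ≤ m ∨ 3 ≤ n) with h3 | h3
      · have : (3 : ℚ) ≤ m := by exact_mod_cast h3
        linarith
      · have : (3 : ℚ) ≤ n := by exact_mod_cast h3
        linarith
    · have h6 : (a₁ : ℚ) + (a₂ + a₃) = 6 := by
        exact_mod_cast (by omega : a₁ + (a₂ + a₃) = 6)
      linarith
  · have := cast_le hu; have := cast_le hv
    simp only [if_true, Nat.cast_one, div_one, if_neg (by omega : ¬ d₃ = 1), Nat.cast_add,
      Nat.cast_zero] at *
    rcases hw with ⟨hw, hw'⟩ | hw
    -- The cost is 3/2 and four leaves are owned, so the gain is at least `20/18 - 1 = 1/9 ≥ 1/16`.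
    · have := four a₁ a₂ hu hv (by linarith)
      linarith
    · linarith
  · have := cast_le hu; have := cast_le hw
    simp only [if_true, Nat.cast_one, div_one, if_neg (by omega : ¬ d₂ = 1), Nat.cast_add,
      Nat.cast_zero] at *
    rcases hv with ⟨hv, hv'⟩ | hv
    · have := four a₁ a₃ hu hw (by linarith)
      linarith
    · linarith
  · have := cast_le hu
    simp only [Nat.cast_one, div_one] at ha
    rcases hv with ⟨hv, -⟩ | hv <;> rcases hw with ⟨hw, -⟩ | hw <;> linarith
  · have := cast_le hv; have := cast_le hw
    simp only [if_true, Nat.cast_one, div_one, if_neg (by omega : ¬ d₁ = 1), Nat.cast_add,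
      Nat.cast_zero] at *
    rcases hu with ⟨hu, hu'⟩ | hu
    · have := four a₂ a₃ hv hw (by linarith)
      linarith
    · linarith
  · have := cast_le hv
    simp only [Nat.cast_one, div_one] at ha
    rcases hu with ⟨hu, -⟩ | hu <;> rcases hw with ⟨hw, -⟩ | hw <;> linarith
  · have := cast_le hw
    simp only [Nat.cast_one, div_one] at ha
    rcases hu with ⟨hu, -⟩ | hu <;> rcases hv with ⟨hv, -⟩ | hv <;> linarith
  · rcases hu with ⟨hu, -⟩ | hu <;> rcases hv with ⟨hv, -⟩ | hv <;>
      rcases hw with ⟨hw, -⟩ | hw <;> linarith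

/-- Shares at each outer vertex recombine to its number of lone leaves, and each lone leaf has
exactly two outer neighbours. -/
theorem sum_leafShare (h : G.IsStarPartition I X P O partner center)
    (hcubic : G.IsRegularOfDegree 3) :
    ∑ z ∈ I, G.leafShare I P O z = 2 * ((G.loneLeaves P).card : ℚ) := by
  have h1 : ∑ z ∈ I, G.leafShare I P O z = ∑ w ∈ O, ∑ z ∈ I.filter (G.Adj w),
      (((G.loneLeaves P).filter (G.Adj w)).card : ℚ) / ((I.filter (G.Adj w)).card : ℚ) := by
    refine Finset.sum_comm' fun z w => ?_
    simp only [Finset.mem_filter, G.adj_comm]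
    tauto
  have h2 : ∑ w ∈ O, ∑ z ∈ I.filter (G.Adj w),
      (((G.loneLeaves P).filter (G.Adj w)).card : ℚ) / ((I.filter (G.Adj w)).card : ℚ) =
      ((∑ w ∈ O, ((G.loneLeaves P).filter (G.Adj w)).card : ℕ) : ℚ) := by
    rw [Nat.cast_sum]
    refine Finset.sum_congr rfl fun w hw => ?_
    have := (h.leafCount_bounds hcubic hw).1
    rw [Finset.sum_const, nsmul_eq_mul, mul_div_cancel₀]
    positivity
  have h3 : ∑ w ∈ O, ((G.loneLeaves P).filter (G.Adj w)).card =
      ∑ ℓ ∈ G.loneLeaves P, (O.filter (G.Adj ℓ)).card := by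
    simp only [Finset.card_eq_sum_ones]
    refine Finset.sum_comm' fun z w => ?_
    simp only [Finset.mem_filter, G.adj_comm]
    tauto
  have h4 : ∀ ℓ ∈ G.loneLeaves P, (O.filter (G.Adj ℓ)).card = 2 := by
    intro ℓ hℓ
    obtain ⟨hℓP, hiso⟩ := mem_isolatedIn.1 hℓ
    have := h.card_leaf hcubic hℓP
    rw [Finset.filter_false_of_mem hiso, Finset.card_empty] at this
    omega
  rw [h1, h2, h3, Finset.sum_congr rfl h4, Finset.sum_const]
  simp [mul_comm]

/-- For every selection there is a set of vertices of `I` whose replacement has the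
expected gain. -/
theorem independentDominationNumber_le_sub_gain
    (h : G.IsStarPartition I X P O partner center) (hcubic : G.IsRegularOfDegree 3)
    {s : V → ZMod 2} (hs : IsSelection X partner s) :
    (G.independentDominationNumber : ℚ) ≤ I.card + X.card / 2 +
      ((freed P center s).card + (G.isolatedIn (freed P center s)).card) / 2 -
      ∑ z ∈ I, G.replacementGain I P O center s z := by
  set E := I.filter fun z => 4 < G.leafShare I P O z ∧
    0 < 5 / 18 * (G.ownedCount I P O center s z : ℚ) - G.replacementCost I O z / 3 with hE
  set L := G.loneLeaves P ∩ freed P center s with hL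
  obtain ⟨Z, hZE, hZ⟩ := exists_subset_hitting (G.owners I O) (G.replacementCost I O) E L
  have hZI : Z ⊆ I := hZE.trans (Finset.filter_subset _ _)
  have hmain := h.independentDominationNumber_le_of_selection hcubic hs hZI fun z hz =>
    h.exists_private_outer hcubic (hZI hz) (Finset.mem_filter.1 (hZE hz)).2.1
  have hgain : ∑ z ∈ I, G.replacementGain I P O center s z =
      ∑ z ∈ E, (5 / 18 * (G.ownedCount I P O center s z : ℚ) - G.replacementCost I O z / 3) := by
    rw [hE, Finset.sum_filter]
    refine Finset.sum_congr rfl fun z _ => ?_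
    unfold replacementGain
    split_ifs with h1 h2 h2
    · exact max_eq_right h2.2.le
    · exact max_eq_left (not_lt.1 fun h3 => h2 ⟨h1, h3⟩)
    · exact absurd h2.1 h1
    · rfl
  have hcount : ∑ z ∈ E, (G.ownedCount I P O center s z : ℚ) =
      ∑ ℓ ∈ L, ((G.owners I O ℓ ∩ E).card : ℚ) := by
    simp only [ownedCount, ← Nat.cast_sum, Finset.card_eq_sum_ones]
    congr 1
    refine Finset.sum_comm' fun z ℓ => ?_
    simp only [hL, Finset.mem_filter, Finset.mem_inter]
    tauto
  have hpow : ∑ ℓ ∈ L, 5 / 18 * ((G.owners I O ℓ ∩ E).card : ℚ) ≤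
      ∑ ℓ ∈ L, (1 - (2 / 3 : ℚ) ^ (G.owners I O ℓ ∩ E).card) := by
    refine Finset.sum_le_sum fun ℓ hℓ => ?_
    have h1 := h.card_owners_le hcubic (mem_isolatedIn.1 (Finset.mem_inter.1 hℓ).1).1
    have h2 : (G.owners I O ℓ ∩ E).card ≤ 2 :=
      (Finset.card_le_card Finset.inter_subset_left).trans h1
    -- The slope 5/18 is the largest linear bound: one owner gives `1/3 > 5/18`, two give exactly
    -- `5/9`.
    interval_cases (G.owners I O ℓ ∩ E).card <;> norm_num
  rw [hgain, Finset.sum_sub_distrib, ← Finset.mul_sum, hcount]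
  rw [← Finset.mul_sum] at hpow
  linarith

/-- A family of selections, parametrised by a group, in which the choices for different pairs of
partners are independent. -/
theorem exists_selections (h : G.IsStarPartition I X P O partner center) :
    ∃ σ : (V → ZMod 2) → V → ZMod 2, (∀ b, IsSelection X partner (σ b)) ∧
      (∀ b x, σ (b + 1) x = σ b x + 1) ∧
      ∀ x ∈ X, ∀ y ∈ X, y ≠ x → y ≠ partner x →
        ∃ e, ∀ b, σ (b + e) x = σ b x + 1 ∧ σ (b + e) y = σ b y := by
  let ι := Fintype.equivFin V
  -- Each pair reads one bit, at its smaller member; `τ` negates it for the other member. Flipping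
  -- that bit affects only this pair.
  let rep : V → V := fun x => if ι x < ι (partner x) then x else partner x
  let τ : V → ZMod 2 := fun x => if ι x < ι (partner x) then 0 else 1
  refine ⟨fun b x => b (rep x) + τ x, ?_, ?_, ?_⟩
  · intro b x hx
    have hne : ι x ≠ ι (partner x) := fun he => (h.adj_partner x hx).ne (ι.injective he)
    simp only [rep, τ, h.partner_partner hx]
    rcases lt_or_gt_of_ne hne with hlt | hlt
    · simp [hlt, hlt.not_gt]
    · simp only [hlt, hlt.not_gt, if_true, if_false, add_assoc]
      congr 1
  · intro b x
    simp only [Pi.add_apply, Pi.one_apply]; ring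
  · intro x hx y hy hyx hyp
    have hne : rep y ≠ rep x := by
      have hpxy : partner y ≠ x := fun he => hyp (by rw [← he, h.partner_partner hy])
      have hpp : partner y ≠ partner x := fun he => hyx (by
        rw [← h.partner_partner hy, he, h.partner_partner hx])
      simp only [rep]
      split_ifs <;> assumption
    refine ⟨Pi.single (rep x) 1, fun b => ⟨?_, ?_⟩⟩
    · simp only [Pi.add_apply, Pi.single_eq_same]; ring
    · simp [Pi.single_eq_of_ne hne]

/-- The centers of adjacent leaves differ because leaves of one center are non-adjacent, and are not
partners because that would close a 4-cycle. Their bits are therefore independent, and exactly one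
of four translates of each `b` frees both leaves. -/
theorem card_eq_four_mul_sum_indicator (h : G.IsStarPartition I X P O partner center)
    (hC4 : G.HasNoFourCycle) {σ : (V → ZMod 2) → V → ZMod 2}
    (hσ : ∀ x ∈ X, ∀ y ∈ X, y ≠ x → y ≠ partner x →
        ∃ e, ∀ b, σ (b + e) x = σ b x + 1 ∧ σ (b + e) y = σ b y)
    {ℓ r : V} (hℓ : ℓ ∈ P) (hr : r ∈ P) (hlr : G.Adj ℓ r) :
    (Fintype.card (V → ZMod 2) : ℚ) =
      4 * ∑ b, if σ b (center ℓ) = 0 ∧ σ b (center r) = 0 then (1 : ℚ) else 0 := by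
  have hcl := h.center_mem ℓ hℓ
  have hcr := h.center_mem r hr
  have hne : center r ≠ center ℓ := fun he => h.not_adj_of_center_eq r hr ℓ hℓ he hlr.symm
  have hnp : center r ≠ partner (center ℓ) := by
    intro he
    have h1 := h.adj_partner _ hcl
    rw [← he] at h1
    refine hC4.false_of_adj hlr (h.adj_center r hr) h1.symm (h.adj_center ℓ hℓ).symm ?_ ?_
    · rintro rfl; exact Finset.disjoint_left.1 h.disj_XP hcr hℓ
    · rintro rfl; exact Finset.disjoint_left.1 h.disj_XP hcl hr
  obtain ⟨e, he⟩ := hσ _ hcl _ hcr hne hnp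
  obtain ⟨e', he'⟩ := hσ _ hcr _ hcl hne.symm fun hc =>
    hnp (by rw [hc, h.partner_partner hcr])
  set f : (V → ZMod 2) → ℚ :=
    fun b => if σ b (center ℓ) = 0 ∧ σ b (center r) = 0 then (1 : ℚ) else 0 with hf
  have hshift : ∀ d, ∑ b, f (b + d) = ∑ b, f b := fun d => Equiv.sum_comp (Equiv.addRight d) f
  have hone : ∀ b, f b + f (b + e) + f (b + e') + f (b + e + e') = 1 := by
    intro b
    simp only [hf, (he _).1, (he _).2, (he' _).1, (he' _).2]
    generalize σ b (center ℓ) = x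
    generalize σ b (center r) = y
    have hx : x = 0 ∨ x = 1 := by revert x; decide
    have hy : y = 0 ∨ y = 1 := by revert y; decide
    have h11 : (1 : ZMod 2) + 1 = 0 := rfl
    rcases hx with rfl | rfl <;> rcases hy with rfl | rfl <;> simp [h11]
  have hsum : ∑ b, (f b + f (b + e) + f (b + e') + f (b + e + e')) =
      ∑ b : V → ZMod 2, (1 : ℚ) := Finset.sum_congr rfl fun b _ => hone b
  simp only [Finset.sum_add_distrib] at hsum
  have hee : ∑ b, f (b + e + e') = ∑ b, f b := by simp only [add_assoc]; exact hshift _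
  rw [hshift, hshift, hee] at hsum
  simp only [Finset.sum_const, Finset.card_univ, nsmul_eq_mul, mul_one] at hsum
  linarith

theorem sum_nonisolated_ge (h : G.IsStarPartition I X P O partner center)
    (hC4 : G.HasNoFourCycle) {σ : (V → ZMod 2) → V → ZMod 2}
    (hσ : ∀ x ∈ X, ∀ y ∈ X, y ≠ x → y ≠ partner x →
        ∃ e, ∀ b, σ (b + e) x = σ b x + 1 ∧ σ (b + e) y = σ b y) :
    (Fintype.card (V → ZMod 2) : ℚ) * ((P.card : ℚ) - (G.loneLeaves P).card) ≤
      4 * ∑ b, (((freed P center (σ b)).card : ℚ) -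
        (G.isolatedIn (freed P center (σ b))).card) := by
  have hsub : G.loneLeaves P ⊆ P := fun ℓ hℓ => (mem_isolatedIn.1 hℓ).1
  have hnb : ∀ ℓ, ∃ r, ℓ ∈ P \ G.loneLeaves P → r ∈ P ∧ G.Adj ℓ r := by
    intro ℓ
    by_cases hℓ : ℓ ∈ P \ G.loneLeaves P
    · obtain ⟨hℓP, hℓA⟩ := Finset.mem_sdiff.1 hℓ
      have : ∃ r ∈ P, G.Adj ℓ r := by
        by_contra! hno; exact hℓA (mem_isolatedIn.2 ⟨hℓP, hno⟩)
      obtain ⟨r, hr⟩ := this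
      exact ⟨r, fun _ => hr⟩
    · exact ⟨ℓ, fun hc => absurd hc hℓ⟩
  choose nb hnb using hnb
  have h1 : ∀ b, ∑ ℓ ∈ P \ G.loneLeaves P,
      (if σ b (center ℓ) = 0 ∧ σ b (center (nb ℓ)) = 0 then (1 : ℚ) else 0) ≤
      ((freed P center (σ b)).card : ℚ) - (G.isolatedIn (freed P center (σ b))).card := by
    intro b
    have hisub : G.isolatedIn (freed P center (σ b)) ⊆ freed P center (σ b) :=
      fun ℓ hℓ => (mem_isolatedIn.1 hℓ).1
    rw [Finset.sum_boole, ← Nat.cast_sub (Finset.card_le_card hisub),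
      ← Finset.card_sdiff_of_subset hisub]
    refine Nat.cast_le.2 (Finset.card_le_card fun ℓ hℓ => ?_)
    obtain ⟨hℓB, hℓ0, hnb0⟩ := Finset.mem_filter.1 hℓ
    obtain ⟨hnbP, hadj⟩ := hnb ℓ hℓB
    refine Finset.mem_sdiff.2 ⟨Finset.mem_filter.2 ⟨(Finset.mem_sdiff.1 hℓB).1, hℓ0⟩, fun hc => ?_⟩
    exact (mem_isolatedIn.1 hc).2 _ (Finset.mem_filter.2 ⟨hnbP, hnb0⟩) hadj
  have h2 := Finset.sum_le_sum fun b (_ : b ∈ Finset.univ) => h1 b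
  rw [Finset.sum_comm] at h2
  have h3 : ∀ ℓ ∈ P \ G.loneLeaves P,
      (∑ b, if σ b (center ℓ) = 0 ∧ σ b (center (nb ℓ)) = 0 then (1 : ℚ) else 0) =
        (Fintype.card (V → ZMod 2) : ℚ) / 4 := by
    intro ℓ hℓ
    have := h.card_eq_four_mul_sum_indicator hC4 hσ (Finset.mem_sdiff.1 hℓ).1 (hnb ℓ hℓ).1 (hnb ℓ hℓ).2
    linarith
  rw [Finset.sum_congr rfl h3, Finset.sum_const, nsmul_eq_mul, Finset.card_sdiff_of_subset hsub,
    Nat.cast_sub (Finset.card_le_card hsub)] at h2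
  linarith

/-- Translating by 1 complements the selection, so every lone leaf is freed exactly once in the pair
`b`, `b + 1`. Averaging the pair bound halves 1/8 to 1/16. -/
theorem sum_replacementGain_ge (h : G.IsStarPartition I X P O partner center)
    (hcubic : G.IsRegularOfDegree 3) (hC4 : G.HasNoFourCycle)
    {σ : (V → ZMod 2) → V → ZMod 2} (hσ : ∀ b x, σ (b + 1) x = σ b x + 1) {z : V} (hz : z ∈ I) :
    (Fintype.card (V → ZMod 2) : ℚ) * ((G.leafShare I P O z - 4) / 16) ≤
      ∑ b, G.replacementGain I P O center (σ b) z := by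
  have hpair : ∀ b, (G.leafShare I P O z - 4) / 8 ≤
      G.replacementGain I P O center (σ b) z + G.replacementGain I P O center (σ (b + 1)) z := by
    intro b
    unfold replacementGain
    split_ifs with ha
    · refine h.gain_pair_bound hcubic hC4 hz ha ?_
      rw [ownedCount, ownedCount, ← Finset.card_union_of_disjoint]
      · congr 1; ext ℓ
        simp only [Finset.mem_union, Finset.mem_filter, Finset.mem_inter, freed, hσ]
        have hor : σ b (center ℓ) = 0 ∨ σ b (center ℓ) + 1 = 0 := by
          generalize σ b (center ℓ) = x; revert x; decide
        have hP : ℓ ∈ G.loneLeaves P → ℓ ∈ P := fun hℓ => (mem_isolatedIn.1 hℓ).1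
        tauto
      · rw [Finset.disjoint_left]
        intro ℓ h1 h2
        simp only [Finset.mem_filter, Finset.mem_inter, freed, hσ] at h1 h2
        have h1 := h1.1.2.2
        have h2 := h2.1.2.2
        rw [h1] at h2
        exact absurd h2 (by decide)
    · linarith
  have h1 := Finset.sum_le_sum fun b (_ : b ∈ Finset.univ) => hpair b
  rw [Finset.sum_add_distrib, Finset.sum_const, Finset.card_univ, nsmul_eq_mul] at h1
  have h2 : ∑ b, G.replacementGain I P O center (σ (b + 1)) z =
      ∑ b, G.replacementGain I P O center (σ b) z :=
    Equiv.sum_comp (Equiv.addRight (1 : V → ZMod 2))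
      fun b => G.replacementGain I P O center (σ b) z
  rw [h2] at h1
  linarith

theorem independentDominationNumber_le_five_fourths
    (h : G.IsStarPartition I X P O partner center) (hcubic : G.IsRegularOfDegree 3)
    (hC4 : G.HasNoFourCycle) :
    (G.independentDominationNumber : ℚ) ≤ 5 / 4 * ((I.card : ℚ) + X.card) := by
  obtain ⟨σ, hsel, hcompl, hflip⟩ := h.exists_selections
  set N : ℚ := (Fintype.card (V → ZMod 2) : ℚ) with hN
  have hNpos : 0 < N := by rw [hN]; exact_mod_cast Fintype.card_pos
  have h1 : ∀ b, (G.independentDominationNumber : ℚ) ≤ I.card + X.card * 3 / 2 -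
      (((freed P center (σ b)).card : ℚ) - (G.isolatedIn (freed P center (σ b))).card) / 2 -
      ∑ z ∈ I, G.replacementGain I P O center (σ b) z := by
    intro b
    have h2 := h.independentDominationNumber_le_sub_gain hcubic (hsel b)
    have h3 : ((freed P center (σ b)).card : ℚ) = X.card := by
      rw [h.card_freed hcubic (hsel b)]
    linarith
  have h2 := Finset.sum_le_sum fun b (_ : b ∈ Finset.univ) => h1 b
  rw [Finset.sum_sub_distrib, Finset.sum_sub_distrib, Finset.sum_const, Finset.sum_const,
    Finset.card_univ, nsmul_eq_mul, nsmul_eq_mul, ← hN, ← Finset.sum_div, Finset.sum_comm] at h2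
  have h3 := h.sum_nonisolated_ge hC4 hflip
  have h4 := Finset.sum_le_sum fun z hz => h.sum_replacementGain_ge hcubic hC4 hcompl (z := z) hz
  rw [← Finset.mul_sum, ← Finset.sum_div, Finset.sum_sub_distrib, h.sum_leafShare hcubic,
    Finset.sum_const, nsmul_eq_mul] at h4
  have h5 : (P.card : ℚ) = 2 * X.card := by rw [h.card_leaves hcubic]; push_cast; rfl
  rw [← hN, h5] at h3
  rw [← hN] at h4
  refine le_of_mul_le_mul_left ?_ hNpos
  linarith

end IsStarPartition

end Averaging

end SimpleGraph

theorem mainTheorem3 {V : Type*} [Fintype V] [Nonempty V]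
    (G : SimpleGraph V) [DecidableRel G.Adj]
    (hcubic : G.IsRegularOfDegree 3) (hC4 : G.HasNoFourCycle) :
    (G.independentDominationNumber : ℚ) / (G.dominationNumber : ℚ) ≤ 5 / 4 := by
  classical
  obtain ⟨I, X, P, O, partner, center, h, hcard⟩ := SimpleGraph.exists_isStarPartition hcubic
  have hmain := h.independentDominationNumber_le_five_fourths hcubic hC4
  rw [← Nat.cast_add, hcard] at hmain
  -- Nonnegativity of the denominator suffices, since division by zero gives zero.
  exact div_le_of_le_mul₀ (Nat.cast_nonneg _) (by norm_num) hmain
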